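/- **Notation.** For $n\ge 1$ let $\mathcal X_n$ be the set of positive definite symmetric real $n\times n$ matrices of determinant $1$, with the Riemannian metric $\langle A,B\rangle_X=\mathrm{tr}(X^{-1}AX^{-1}B)$, its Riemannian distance $d$, and the action $g.X=g^{\mathsf T}Xg$ of $SL(n,\mathbb R)$. Let $\overline{\mathcal X_n}$ be its standard Satake compactification, the space of projective classes of nonzero positive semidefinite symmetric $n\times n$ matrices with the projective topology. For a subspace $0\ne V\subsetneq\mathbb R^n$ the boundary component $\partial_S(V)$ consists of the classes with column space $V$; its type is $\dim V$, and its boundary is the union of all $\partial_S(W)$ with $0\neq W\subsetneq V$. *Busemann functions.* A unit-speed geodesic ray is $\gamma(t)=g^{\mathsf T}\exp(tA)g$ ($t\ge 0$) with $g\in SL(n,\mathbb R)$, $A=A^{\mathsf T}$, $\mathrm{tr}A=0$, $\mathrm{tr}(A^2)=1$. Two rays are equivalent if $\limsup_{t\to\infty}d(\gamma_1(t),\gamma_2(t))<\infty$; the visual boundary $\partial_\infty\mathcal X_n$ is the set of equivalence classes. For $0\ne V\subsetneq\mathbb R^n$ the vertex $\xi_V$ is the class of the rays for which $A$ has exactly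 two eigenvalues and $V=g^{\mathsf T}W$, where $W$ is the eigenspace of the larger one. Write $\xi_{\mathbf v}=\xi_{\mathrm{span}(\mathbf v)}$. The classical Busemann function is $$b_{\xi,X}(Y)=\lim_{t\to\infty}\bigl(d(\gamma(t),Y)-d(\gamma(t),X)\bigr),\qquad \gamma\in\xi .$$ *Busemann–Selberg functions.* Let $\mathfrak s(X,Y)=\mathrm{tr}(X^{-1}Y)$. For $\alpha\in\overline{\mathcal X_n}\setminus\mathcal X_n$ and $X,Y\in\mathcal X_n$, the type-$0$ function is $$\mathfrak b_{\alpha,X}(Y)=\lim_{A\to\alpha,\ A\in\mathcal X_n}\frac{\mathfrak s(Y,A)}{\mathfrak s(X,A)} .$$ Let $\Pi=\partial_S(V)$ have type $n-k$, let $\iota$ be an $n\times(n-k)$ matrix whose columns are an orthonormal basis of $V$, and put $\pi(X)=\iota^{\mathsf T}X\iota/\det(\iota^{\mathsf T}X\iota)^{1/(n-k)}\in\mathcal X_{n-k}$ for $X\in\mathcal X_n$. For $\alpha$ in the boundary of $\Pi$ let $\pi(\alpha)=[\iota^{\mathsf T}\alpha\iota]\in\overline{\mathcal X_{n-k}}$.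 The type-$k$ function is $$\mathfrak b^{(k)}_{\Pi;\alpha,X}(Y)=\mathfrak b_{\pi(\alpha),\,\pi(X^{-1})^{-1}}\bigl(\pi(Y^{-1})^{-1}\bigr).$$ **Proposition.** Let $k\ge 1$ and $n-k\ge 2$. Let $\Pi=\partial_S(V)$ be a boundary component of type $n-k$, and let $\alpha=\mathbf v\otimes\mathbf v$ (the class of $\mathbf v\mathbf v^{\mathsf T}$, with $\mathbf v\neq 0$) be a Satake point on the boundary of $\Pi$, so that $\mathbf v\in V$. Let $X,Y\in\mathcal X_n$. Then the limits that define $\mathfrak b_{\alpha,X}(Y)$, $\mathfrak b^{(k)}_{\Pi;\alpha,X}(Y)$, $b_{\xi_{\mathbf v},X}(Y)$ and $b_{\xi_V,X}(Y)$ exist, the last two being the same for all rays $\gamma$ in the class; the first two are positive, and $$\log\mathfrak b_{\alpha,X}(Y)=\sqrt{\frac{n-1}{n}}\;b_{\xi_{\mathbf v},X}(Y),$$ $$\log\mathfrak b^{(k)}_{\Pi;\alpha,X}(Y)=\sqrt{\frac{n-1}{n}}\;b_{\xi_{\mathbf v},X}(Y)-\sqrt{\frac{k}{n(n-k)}}\;b_{\xi_V,X}(Y).$$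 The second formula holds for every choice of $\iota$. -/

import Mathlib

open Filter Topology Matrix
open scoped ENNReal LinearAlgebra.Projectivization

noncomputable section

/-! ### The symmetric space `SL(n,ℝ)/SO(n)`, hypersurface model -/

/-- Positive definite real symmetric `n × n` matrices of determinant one. -/
def SymSpace (n : ℕ) : Type :=
  {X : Matrix (Fin n) (Fin n) ℝ // X.PosDef ∧ X.det = 1}

namespace SymSpace

/-- The underlying matrix. -/
def mat {n : ℕ} (X : SymSpace n) : Matrix (Fin n) (Fin n) ℝ := X.1

/-- The inverse matrix, again a point of the space. -/
def inv {n : ℕ} (X : SymSpace n) : SymSpace n :=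
  ⟨X.mat⁻¹, X.2.1.inv, by
    have h := X.2.2
    simp only [mat, Matrix.det_nonsing_inv, h, Ring.inverse_one]⟩

end SymSpace

/-- A `C¹` curve `[0,1] → SymSpace n` from `X` to `Y`, as a curve of matrices together with its
(continuous) velocity; differentiability is one-sided at the end points. -/
structure C1Curve {n : ℕ} (X Y : SymSpace n) where
  curve : ℝ → Matrix (Fin n) (Fin n) ℝ
  vel : ℝ → Matrix (Fin n) (Fin n) ℝ
  mem : ∀ t ∈ Set.Icc (0 : ℝ) 1, (curve t).PosDef ∧ (curve t).det = 1
  hasDeriv : ∀ t ∈ Set.Icc (0 : ℝ) 1, ∀ i j,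
    HasDerivWithinAt (fun s => curve s i j) (vel t i j) (Set.Icc 0 1) t
  vel_cont : ContinuousOn vel (Set.Icc 0 1)
  source : curve 0 = X.mat
  target : curve 1 = Y.mat

/-- The length of a `C¹` curve for the metric tensor `⟨A, B⟩_X = tr (X⁻¹ A X⁻¹ B)`. -/
def C1Curve.length {n : ℕ} {X Y : SymSpace n} (c : C1Curve X Y) : ℝ :=
  ∫ t in (0 : ℝ)..1,
    Real.sqrt (((c.curve t)⁻¹ * c.vel t * (c.curve t)⁻¹ * c.vel t).trace)

/-- `JoinedBy X Y L`: there is a piecewise `C¹` curve (a finite concatenation of `C¹` curves)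
of length `L` from `X` to `Y`. -/
inductive JoinedBy {n : ℕ} : SymSpace n → SymSpace n → ℝ → Prop
  | single {X Y : SymSpace n} (c : C1Curve X Y) : JoinedBy X Y c.length
  | concat {X Y Z : SymSpace n} {L M : ℝ} :
      JoinedBy X Y L → JoinedBy Y Z M → JoinedBy X Z (L + M)

/-- The Riemannian distance with values in `[0,∞]`: infimum of the lengths of piecewise `C¹`
curves. -/
def riemEDist {n : ℕ} (X Y : SymSpace n) : ℝ≥0∞ :=
  ⨅ (L : ℝ) (_ : JoinedBy X Y L), ENNReal.ofReal L

/-- The Riemannian distance as a real number. -/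
def riemDist {n : ℕ} (X Y : SymSpace n) : ℝ := (riemEDist X Y).toReal

lemma joinedBy_refl {n : ℕ} (X : SymSpace n) : JoinedBy X X 0 := by
  let c : C1Curve X X :=
    { curve := fun _ => X.mat
      vel := fun _ => 0
      mem := fun _ _ => X.2
      hasDeriv := fun t _ i j => by simpa using hasDerivWithinAt_const t _ (X.mat i j)
      vel_cont := continuousOn_const
      source := rfl
      target := rfl }
  have h : c.length = 0 := by simp [C1Curve.length, c]
  exact h ▸ JoinedBy.single c

lemma joinedBy_symm {n : ℕ} {X Y : SymSpace n} {L : ℝ} (h : JoinedBy X Y L) :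
    JoinedBy Y X L := by
  induction h with
  | @single X Y c =>
    have hm : ∀ t ∈ Set.Icc (0 : ℝ) 1, 1 - t ∈ Set.Icc (0 : ℝ) 1 := fun t ht =>
      ⟨by linarith [ht.2], by linarith [ht.1]⟩
    let d : C1Curve Y X :=
      { curve := fun t => c.curve (1 - t)
        vel := fun t => - c.vel (1 - t)
        mem := fun t ht => c.mem _ (hm t ht)
        hasDeriv := fun t ht i j => by
          have h1 : HasDerivWithinAt (fun s : ℝ => 1 - s) (-1) (Set.Icc 0 1) t := by
            simpa using (hasDerivWithinAt_id t (Set.Icc (0 : ℝ) 1)).const_sub 1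
          have h2 := (c.hasDeriv _ (hm t ht) i j).comp t h1 hm
          simpa [Function.comp_def] using h2
        vel_cont := (c.vel_cont.comp (by fun_prop) hm).neg
        source := by simpa using c.target
        target := by simpa using c.source }
    have h : d.length = c.length := by
      have := intervalIntegral.integral_comp_sub_left (a := 0) (b := 1) (fun t =>
        Real.sqrt (((c.curve t)⁻¹ * c.vel t * (c.curve t)⁻¹ * c.vel t).trace)) 1
      simpa [C1Curve.length, d] using this
    exact h ▸ JoinedBy.single d
  | concat _ _ ih1 ih2 => rw [add_comm]; exact JoinedBy.concat ih2 ih1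

lemma riemEDist_self {n : ℕ} (X : SymSpace n) : riemEDist X X = 0 :=
  le_antisymm ((iInf₂_le 0 (joinedBy_refl X)).trans (by simp)) zero_le

lemma riemEDist_comm {n : ℕ} (X Y : SymSpace n) : riemEDist X Y = riemEDist Y X :=
  le_antisymm (le_iInf₂ fun L h => iInf₂_le L (joinedBy_symm h))
    (le_iInf₂ fun L h => iInf₂_le L (joinedBy_symm h))

lemma riemEDist_triangle {n : ℕ} (X Y Z : SymSpace n) :
    riemEDist X Z ≤ riemEDist X Y + riemEDist Y Z := by
  simp only [riemEDist, ENNReal.iInf_add, ENNReal.add_iInf]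
  refine le_iInf₂ fun M hM => le_iInf₂ fun L hL => ?_
  exact (iInf₂_le (L + M) (JoinedBy.concat hL hM)).trans ENNReal.ofReal_add_le

/-! ### Geodesic rays and the visual boundary -/

/-- Data of a unit-speed geodesic ray `t ↦ g.exp (tA) = gᵀ exp (tA) g`: an element `g` of
`SL(n,ℝ)` and a traceless symmetric matrix `A` with `tr (A²) = 1`. -/
structure GeodesicRay (n : ℕ) where
  g : Matrix.SpecialLinearGroup (Fin n) ℝ
  A : Matrix (Fin n) (Fin n) ℝ
  symm : A.IsSymm
  trace_zero : A.trace = 0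
  unit_speed : (A * A).trace = 1

lemma posDef_exp {n : ℕ} {A : Matrix (Fin n) (Fin n) ℝ} (hA : A.IsSymm) :
    (NormedSpace.exp A).PosDef := by
  have h2 : NormedSpace.exp A
      = (NormedSpace.exp ((1 / 2 : ℝ) • A))ᴴ * NormedSpace.exp ((1 / 2 : ℝ) • A) := by
    rw [Matrix.conjTranspose_eq_transpose_of_trivial, ← Matrix.exp_transpose,
      Matrix.transpose_smul, hA.eq, ← Matrix.exp_add_of_commute _ _ (Commute.refl _),
      ← add_smul]
    norm_num
  rw [h2]
  refine Matrix.PosDef.conjTranspose_mul_self _ ?_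
  exact Matrix.mulVec_injective_of_isUnit (Matrix.isUnit_exp _)

lemma det_exp_eq_one {n : ℕ} {A : Matrix (Fin n) (Fin n) ℝ} (hA : A.IsSymm)
    (h0 : A.trace = 0) : (NormedSpace.exp A).det = 1 := by
  have hH : A.IsHermitian := by
    rw [Matrix.IsHermitian, Matrix.conjTranspose_eq_transpose_of_trivial]; exact hA
  have hs := hH.spectral_theorem
  have htr := hH.trace_eq_sum_eigenvalues
  rw [Unitary.conjStarAlgAut_apply] at hs
  set U : Matrix (Fin n) (Fin n) ℝ := (hH.eigenvectorUnitary : Matrix (Fin n) (Fin n) ℝ) with hU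
  have hUU : U * star U = 1 := Unitary.mul_star_self_of_mem hH.eigenvectorUnitary.2
  have hUu : IsUnit U := IsUnit.of_mul_eq_one _ hUU
  have hinv : star U = U⁻¹ := (Matrix.inv_eq_right_inv hUU).symm
  rw [hinv] at hs
  rw [hs, Matrix.exp_conj _ _ hUu, Matrix.det_conj hUu, Matrix.exp_diagonal, Matrix.det_diagonal]
  rw [h0] at htr
  have : ∀ i, NormedSpace.exp (RCLike.ofReal ∘ hH.eigenvalues : Fin n → ℝ) i
      = Real.exp (hH.eigenvalues i) := by
    intro i
    rw [Pi.coe_exp, ← Real.exp_eq_exp_ℝ]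
    rfl
  simp only [this]
  rw [← Real.exp_sum]
  have h3 : ∑ i, hH.eigenvalues i = 0 := by simpa using htr.symm
  rw [h3, Real.exp_zero]

/-- The point of the ray at time `t`. -/
def GeodesicRay.point {n : ℕ} (r : GeodesicRay n) (t : ℝ) : SymSpace n :=
  ⟨(r.g : Matrix (Fin n) (Fin n) ℝ)ᵀ * NormedSpace.exp (t • r.A) * r.g, by
    have hs : (t • r.A).IsSymm := r.symm.smul t
    constructor
    · rw [← Matrix.conjTranspose_eq_transpose_of_trivial]
      refine (posDef_exp hs).conjTranspose_mul_mul_same (Matrix.mulVec_injective_of_isUnit ?_)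
      rw [Matrix.isUnit_iff_isUnit_det]
      simp
    · have := det_exp_eq_one hs (by simp [Matrix.trace_smul, r.trace_zero])
      simp [this]⟩

/-- Two rays are asymptotic if `limsup_{t → ∞} d(γ₁(t), γ₂(t)) < ∞`. -/
def GeodesicRay.Asymptotic {n : ℕ} (r s : GeodesicRay n) : Prop :=
  limsup (fun t : ℝ => riemEDist (r.point t) (s.point t)) atTop < ⊤

lemma GeodesicRay.asymptotic_iff {n : ℕ} (r s : GeodesicRay n) :
    r.Asymptotic s ↔
      ∃ C : ℝ≥0∞, C < ⊤ ∧ ∀ᶠ t : ℝ in atTop, riemEDist (r.point t) (s.point t) ≤ C := by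
  constructor
  · intro h
    obtain ⟨C, h1, h2⟩ := exists_between h
    exact ⟨C, h2, (eventually_lt_of_limsup_lt h1).mono fun _ h => h.le⟩
  · rintro ⟨C, hC, h⟩
    exact (limsup_le_of_le (by isBoundedDefault) h).trans_lt hC

/-- The relation of being asymptotic, as an equivalence relation. -/
instance geodesicRaySetoid (n : ℕ) : Setoid (GeodesicRay n) where
  r := GeodesicRay.Asymptotic
  iseqv :=
    { refl := fun r => (r.asymptotic_iff r).2 ⟨0, by simp, by simp [riemEDist_self]⟩
      symm := fun {r s} h => by
        simpa only [GeodesicRay.Asymptotic, riemEDist_comm] using h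
      trans := fun {r s u} h1 h2 => by
        obtain ⟨C, hC, h1⟩ := (r.asymptotic_iff s).1 h1
        obtain ⟨D, hD, h2⟩ := (s.asymptotic_iff u).1 h2
        refine (r.asymptotic_iff u).2 ⟨C + D, ENNReal.add_lt_top.2 ⟨hC, hD⟩, ?_⟩
        filter_upwards [h1, h2] with t a b
        exact (riemEDist_triangle _ _ _).trans (add_le_add a b) }

/-- The visual boundary: asymptotic classes of unit-speed geodesic rays. -/
def VisualBoundary (n : ℕ) : Type := Quotient (geodesicRaySetoid n)

/-- The class of a ray in the visual boundary. -/
def GeodesicRay.endpoint {n : ℕ} (r : GeodesicRay n) : VisualBoundary n :=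
  Quotient.mk (geodesicRaySetoid n) r

/-- The function `t ↦ d(γ(t), Y) - d(γ(t), X)`. -/
def busemannDiff {n : ℕ} (r : GeodesicRay n) (X Y : SymSpace n) (t : ℝ) : ℝ :=
  riemDist (r.point t) Y - riemDist (r.point t) X

/-- The classical Busemann function `b_{ξ,X}(Y) = lim_{t → ∞} (d(γ(t), Y) - d(γ(t), X))`,
for a ray `γ` in the class `ξ`. -/
def busemann {n : ℕ} (ξ : VisualBoundary n) (X Y : SymSpace n) : ℝ :=
  limUnder atTop (busemannDiff (Quotient.out ξ) X Y)

/-- The sum of the eigenspaces of `A` for the eigenvalues `≥ c`, moved by `g`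
(which acts on vectors by `x ↦ gᵀ x`, in accordance with `g.X = gᵀ X g`). -/
def GeodesicRay.upperSpace {n : ℕ} (r : GeodesicRay n) (c : ℝ) : Submodule ℝ (Fin n → ℝ) :=
  (⨆ (μ : ℝ) (_ : c ≤ μ), Module.End.eigenspace (Matrix.toLin' r.A) μ).map
    (Matrix.toLin' (r.g : Matrix (Fin n) (Fin n) ℝ)ᵀ)

/-- The flag of proper nonzero subspaces determined by a ray. -/
def GeodesicRay.flag {n : ℕ} (r : GeodesicRay n) : Set (Submodule ℝ (Fin n → ℝ)) :=
  {U | (∃ c, U = r.upperSpace c) ∧ U ≠ ⊥ ∧ U ≠ ⊤}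

/-- `ξ` is the vertex `ξ_V` of the visual boundary: the class of a ray whose flag consists of
the single subspace `V`. -/
def IsIdealVertex {n : ℕ} (ξ : VisualBoundary n) (V : Submodule ℝ (Fin n → ℝ)) : Prop :=
  ∃ r : GeodesicRay n, r.endpoint = ξ ∧ r.flag = {V}

/-! ### The standard Satake compactification -/

/-- The space of real symmetric matrices. -/
def symMatrices (n : ℕ) : Submodule ℝ (Matrix (Fin n) (Fin n) ℝ) where
  carrier := {M | M.IsSymm}
  add_mem' := fun ha hb => ha.add hb
  zero_mem' := Matrix.isSymm_zero
  smul_mem' := fun c _ h => h.smul c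

/-- The projective topology (quotient topology from the nonzero vectors). -/
instance projSymTopology (n : ℕ) : TopologicalSpace (ℙ ℝ (symMatrices n)) :=
  inferInstanceAs (TopologicalSpace (Quotient (projectivizationSetoid ℝ (symMatrices n))))

/-- The standard Satake compactification: projective classes of nonzero positive semidefinite
symmetric matrices, with the subspace topology. -/
def SatakeCompactification (n : ℕ) : Type :=
  {p : ℙ ℝ (symMatrices n) // ∃ (S : symMatrices n) (hS : S ≠ 0),
    (S : Matrix (Fin n) (Fin n) ℝ).PosSemidef ∧ Projectivization.mk ℝ S hS = p}

instance satakeTopology (n : ℕ) : TopologicalSpace (SatakeCompactification n) :=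
  inferInstanceAs (TopologicalSpace (Subtype _))

/-- The class of a nonzero positive semidefinite matrix. -/
def satakePoint {n : ℕ} (S : Matrix (Fin n) (Fin n) ℝ) (hS : S.PosSemidef) (h0 : S ≠ 0) :
    SatakeCompactification n :=
  ⟨Projectivization.mk ℝ (⟨S, by
      have h := hS.1
      rw [Matrix.IsHermitian, Matrix.conjTranspose_eq_transpose_of_trivial] at h
      exact h⟩ : symMatrices n) (fun h => h0 (congrArg Subtype.val h)), _, _, hS, rfl⟩

/-- The rank-one point `v ⊗ v`, the class of the matrix `v vᵀ`. -/
def rankOnePoint {n : ℕ} (v : Fin n → ℝ) (hv : v ≠ 0) : SatakeCompactification n :=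
  satakePoint (Matrix.vecMulVec v v)
    (by simpa using Matrix.posSemidef_vecMulVec_self_star v)
    (by
      intro h
      apply hv
      funext i
      have := congrFun (congrFun h i) i
      simpa [Matrix.vecMulVec_apply] using this)

/-- A representing matrix (defined up to a nonzero factor). -/
def SatakeCompactification.rep {n : ℕ} (α : SatakeCompactification n) :
    Matrix (Fin n) (Fin n) ℝ := (α.1.rep : symMatrices n)

lemma SatakeCompactification.rep_ne_zero {n : ℕ} (α : SatakeCompactification n) :
    α.rep ≠ 0 := fun h => α.1.rep_nonzero (Subtype.ext h)

lemma SatakeCompactification.rep_isSymm {n : ℕ} (α : SatakeCompactification n) :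
    α.rep.IsSymm := (α.1.rep : symMatrices n).2

lemma SatakeCompactification.pos {n : ℕ} (α : SatakeCompactification n) : 0 < n := by
  rcases Nat.eq_zero_or_pos n with h | h
  · subst h
    exact absurd (Subsingleton.elim _ _) α.rep_ne_zero
  · exact h

/-- The inclusion of the symmetric space in its compactification. -/
def SymSpace.toSatake {n : ℕ} (hn : 0 < n) (X : SymSpace n) : SatakeCompactification n :=
  satakePoint X.mat X.2.1.posSemidef (by
    intro h
    have h1 := X.2.2
    have h2 : X.1 = 0 := h
    have : Nonempty (Fin n) := ⟨⟨0, hn⟩⟩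
    rw [h2, Matrix.det_zero] at h1
    exact zero_ne_one h1)

/-- The column space of a point of the compactification. -/
def SatakeCompactification.colSpace {n : ℕ} (α : SatakeCompactification n) :
    Submodule ℝ (Fin n → ℝ) := LinearMap.range α.rep.mulVecLin

/-- The component `∂_S(V)`: classes with column space `V`. -/
def satakeComponent {n : ℕ} (V : Submodule ℝ (Fin n → ℝ)) : Set (SatakeCompactification n) :=
  {α | α.colSpace = V}

/-- The boundary of `∂_S(V)`: the union of the components `∂_S(W)` with `W ⊊ V`. -/
def satakeComponentBoundary {n : ℕ} (V : Submodule ℝ (Fin n → ℝ)) :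
    Set (SatakeCompactification n) := ⋃ W < V, satakeComponent W

/-! ### Busemann-Selberg functions -/

/-- Selberg's invariant `tr (X⁻¹ Y)`. -/
def selbergInvariant {n : ℕ} (X Y : SymSpace n) : ℝ := (X.mat⁻¹ * Y.mat).trace

/-- The filter on the symmetric space of points tending to `α` in the Satake compactification:
`Tendsto A l (satakeApproach α)` says that `A` converges to `α` along `l`. -/
def satakeApproach {n : ℕ} (α : SatakeCompactification n) : Filter (SymSpace n) :=
  comap (SymSpace.toSatake α.pos) (𝓝 α)

/-- The quotient `𝔰(Y, A) / 𝔰(X, A)`. -/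
def selbergRatio {n : ℕ} (X Y A : SymSpace n) : ℝ := selbergInvariant Y A / selbergInvariant X A

/-- The type-`0` Busemann-Selberg function `𝔟_{α,X}(Y)`: the limit of `𝔰(Y, A) / 𝔰(X, A)` as
`A` tends to `α` in the symmetric space. -/
def busemannSelberg {n : ℕ} (α : SatakeCompactification n) (X Y : SymSpace n) : ℝ :=
  limUnder (satakeApproach α) (selbergRatio X Y)

/-- The columns of `ι` form an orthonormal basis of `V`. -/
def IsOrthonormalFrame {n m : ℕ} (ι : Matrix (Fin n) (Fin m) ℝ)
    (V : Submodule ℝ (Fin n → ℝ)) : Prop :=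
  ιᵀ * ι = 1 ∧ LinearMap.range ι.mulVecLin = V

lemma IsOrthonormalFrame.mulVec_injective {n m : ℕ} {ι : Matrix (Fin n) (Fin m) ℝ}
    {V : Submodule ℝ (Fin n → ℝ)} (h : IsOrthonormalFrame ι V) :
    Function.Injective ι.mulVec := by
  intro x y hxy
  have := congrArg (ιᵀ).mulVec hxy
  simpa [Matrix.mulVec_mulVec, h.1] using this

/-- The projection `π_V(X) = ιᵀ X ι / det(ιᵀ X ι)^{1/m}` to the symmetric space of `SL(m,ℝ)`. -/
def SymSpace.proj {n m : ℕ} {ι : Matrix (Fin n) (Fin m) ℝ} {V : Submodule ℝ (Fin n → ℝ)}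
    (h : IsOrthonormalFrame ι V) (X : SymSpace n) : SymSpace m :=
  ⟨((ιᵀ * X.mat * ι).det ^ (1 / (m : ℝ)))⁻¹ • (ιᵀ * X.mat * ι), by
    have hp : (ιᵀ * X.mat * ι).PosDef := by
      rw [← Matrix.conjTranspose_eq_transpose_of_trivial]
      exact X.2.1.conjTranspose_mul_mul_same h.mulVec_injective
    have hd := hp.det_pos
    have hc := Real.rpow_pos_of_pos hd (1 / (m : ℝ))
    refine ⟨hp.smul (inv_pos.2 hc), ?_⟩
    rw [Matrix.det_smul, Fintype.card_fin]
    rcases Nat.eq_zero_or_pos m with hm | hm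
    · subst hm
      simp
    · rw [inv_pow, ← Real.rpow_natCast, ← Real.rpow_mul hd.le, one_div,
        inv_mul_cancel₀ (by positivity), Real.rpow_one, inv_mul_cancel₀ hd.ne']⟩

lemma IsOrthonormalFrame.compress_ne_zero {n m : ℕ} {ι : Matrix (Fin n) (Fin m) ℝ}
    {V : Submodule ℝ (Fin n → ℝ)} (h : IsOrthonormalFrame ι V)
    {S : Matrix (Fin n) (Fin n) ℝ} (hS : S.IsSymm) (h0 : S ≠ 0)
    (hV : LinearMap.range S.mulVecLin ≤ V) : ιᵀ * S * ι ≠ 0 := by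
  intro hz
  have h1 : ι * ιᵀ * S = S := by
    apply Matrix.ext_of_mulVec_single
    intro i
    have hx : S.mulVec (Pi.single i 1) ∈ LinearMap.range ι.mulVecLin := by
      rw [h.2]; exact hV ⟨_, rfl⟩
    obtain ⟨y, hy⟩ := hx
    rw [Matrix.mulVecLin_apply] at hy
    rw [← Matrix.mulVec_mulVec, ← hy, Matrix.mulVec_mulVec, Matrix.mul_assoc, h.1, Matrix.mul_one]
  have h2 : S * (ι * ιᵀ) = S := by
    have := congrArg Matrix.transpose h1
    simpa [Matrix.transpose_mul, hS.eq, Matrix.mul_assoc] using this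
  apply h0
  calc S = ι * (ιᵀ * S * ι) * ιᵀ := by
        rw [← Matrix.mul_assoc, ← Matrix.mul_assoc, h1, Matrix.mul_assoc, h2]
    _ = 0 := by rw [hz]; simp

lemma colSpace_le_of_mem_boundary {n : ℕ} {V : Submodule ℝ (Fin n → ℝ)}
    {α : SatakeCompactification n} (hα : α ∈ satakeComponentBoundary V) : α.colSpace ≤ V := by
  simp only [satakeComponentBoundary, Set.mem_iUnion] at hα
  obtain ⟨W, hW, h⟩ := hα
  have h' : α.colSpace = W := h
  rw [h']
  exact hW.le

/-- The projection `[S] ↦ [ιᵀ S ι]` on the boundary of `∂_S(V)`. -/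
def SatakeCompactification.proj {n m : ℕ} {ι : Matrix (Fin n) (Fin m) ℝ}
    {V : Submodule ℝ (Fin n → ℝ)} (h : IsOrthonormalFrame ι V) (α : SatakeCompactification n)
    (hα : α ∈ satakeComponentBoundary V) : SatakeCompactification m :=
  ⟨Projectivization.mk ℝ (⟨ιᵀ * α.rep * ι, by
      have := α.rep_isSymm
      change (ιᵀ * α.rep * ι)ᵀ = _
      simp [Matrix.transpose_mul, this.eq, Matrix.mul_assoc]⟩ : symMatrices m)
      (fun hz => h.compress_ne_zero α.rep_isSymm α.rep_ne_zero
        (colSpace_le_of_mem_boundary hα) (congrArg Subtype.val hz)), by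
    obtain ⟨S, hS0, hS, hp⟩ := α.2
    have hpsd : (ιᵀ * (S : Matrix (Fin n) (Fin n) ℝ) * ι).PosSemidef := by
      rw [← Matrix.conjTranspose_eq_transpose_of_trivial]
      exact hS.conjTranspose_mul_mul_same ι
    have hr : Projectivization.mk ℝ S hS0 = Projectivization.mk ℝ α.1.rep α.1.rep_nonzero := by
      rw [hp, Projectivization.mk_rep]
    obtain ⟨a, ha⟩ := (Projectivization.mk_eq_mk_iff' ℝ _ _ _ _).1 hr
    have ha' : (S : Matrix (Fin n) (Fin n) ℝ) = a • α.rep := (congrArg Subtype.val ha).symm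
    have hcomp : ιᵀ * (S : Matrix (Fin n) (Fin n) ℝ) * ι = a • (ιᵀ * α.rep * ι) := by
      rw [ha']; simp
    have ha0 : a ≠ 0 := by
      rintro rfl
      exact hS0 (Subtype.ext (by simpa using ha'))
    have hnz := h.compress_ne_zero α.rep_isSymm α.rep_ne_zero (colSpace_le_of_mem_boundary hα)
    refine ⟨⟨ιᵀ * (S : Matrix (Fin n) (Fin n) ℝ) * ι, ?_⟩, ?_, hpsd, ?_⟩
    · have h1 := hpsd.1
      rw [Matrix.IsHermitian, Matrix.conjTranspose_eq_transpose_of_trivial] at h1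
      exact h1
    · intro hz
      have hz' : ιᵀ * (S : Matrix (Fin n) (Fin n) ℝ) * ι = 0 := congrArg Subtype.val hz
      rw [hcomp] at hz'
      exact (smul_ne_zero ha0 hnz) hz'
    · rw [Projectivization.mk_eq_mk_iff']
      exact ⟨a, Subtype.ext hcomp.symm⟩⟩

/-- The reference points `π(X⁻¹)⁻¹` entering the definition of higher type. -/
def SymSpace.dualProj {n m : ℕ} {ι : Matrix (Fin n) (Fin m) ℝ} {V : Submodule ℝ (Fin n → ℝ)}
    (h : IsOrthonormalFrame ι V) (X : SymSpace n) : SymSpace m := (X.inv.proj h).inv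

/-- The Busemann-Selberg function `𝔟^{(k)}_{Π;α,X}(Y)` of type `k = n - m` for the component
`Π = ∂_S(V)` with `dim V = m` and a point `α` of its boundary:
`𝔟_{π(α), π(X⁻¹)⁻¹}(π(Y⁻¹)⁻¹)`. -/
def busemannSelbergHigher {n m : ℕ} {ι : Matrix (Fin n) (Fin m) ℝ}
    {V : Submodule ℝ (Fin n → ℝ)} (h : IsOrthonormalFrame ι V) (α : SatakeCompactification n)
    (hα : α ∈ satakeComponentBoundary V) (X Y : SymSpace n) : ℝ :=
  busemannSelberg (α.proj h hα) (X.dualProj h) (Y.dualProj h)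


lemma exists_isOrthonormalFrame {n m : ℕ} (V : Submodule ℝ (Fin n → ℝ))
    (hm : Module.finrank ℝ V = m) :
    ∃ ι : Matrix (Fin n) (Fin m) ℝ, IsOrthonormalFrame ι V := by
  subst hm
  let e := WithLp.linearEquiv 2 ℝ (Fin n → ℝ)
  let W : Submodule ℝ (EuclideanSpace ℝ (Fin n)) := V.map e.symm.toLinearMap
  have hd : Module.finrank ℝ W = Module.finrank ℝ V := LinearEquiv.finrank_map_eq e.symm V
  let b := (stdOrthonormalBasis ℝ W).reindex (finCongr hd)
  let ι : Matrix (Fin n) (Fin (Module.finrank ℝ V)) ℝ :=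
    Matrix.of fun i j => (b j : EuclideanSpace ℝ (Fin n)) i
  have h1 : ιᵀ * ι = 1 := by
    ext i j
    have h := orthonormal_iff_ite.1 b.orthonormal i j
    rw [Submodule.coe_inner, PiLp.inner_apply] at h
    rw [Matrix.mul_apply, Matrix.one_apply, ← h]
    exact Finset.sum_congr rfl fun x _ => by simp [ι, mul_comm]
  have hinj : Function.Injective ι.mulVecLin := by
    intro x y hxy
    have := congrArg (ιᵀ).mulVec hxy
    simpa [Matrix.mulVec_mulVec, h1] using this
  refine ⟨ι, h1, ?_⟩
  apply Submodule.eq_of_le_of_finrank_eq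
  · rintro _ ⟨x, rfl⟩
    have : ι.mulVecLin x = ∑ j, x j • e (b j : EuclideanSpace ℝ (Fin n)) := by
      ext i
      simp [Matrix.mulVec, dotProduct, ι, e, mul_comm]
    rw [this]
    refine V.sum_mem fun j _ => V.smul_mem _ ?_
    obtain ⟨y, hy, hyb⟩ := (b j).2
    rw [← hyb]
    simpa using hy
  · rw [LinearMap.finrank_range_of_inj hinj]; simp

/-- Every proper nonzero subspace has its vertex in the visual boundary. -/
lemma exists_isIdealVertex {n : ℕ} (V : Submodule ℝ (Fin n → ℝ)) (h0 : V ≠ ⊥) (h1 : V ≠ ⊤) :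
    ∃ ξ : VisualBoundary n, IsIdealVertex ξ V := by
  obtain ⟨m, hm⟩ : ∃ m, m = Module.finrank ℝ V := ⟨_, rfl⟩
  obtain ⟨ι, hι, hr⟩ := exists_isOrthonormalFrame V hm.symm
  have hm0 : 0 < m := by
    rw [hm, Module.finrank_pos_iff]; exact Submodule.nontrivial_iff_ne_bot.2 h0
  have hmn : m < n := by
    have := Submodule.finrank_lt h1; rw [← hm] at this; simpa using this
  have hmR : (0 : ℝ) < m := by exact_mod_cast hm0
  have hkR : (0 : ℝ) < (n : ℝ) - m := by
    have : (m : ℝ) < n := by exact_mod_cast hmn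
    linarith
  have hnR : (0 : ℝ) < n := by linarith
  set P : Matrix (Fin n) (Fin n) ℝ := ι * ιᵀ with hP
  have hPP : P * P = P := by
    rw [hP, Matrix.mul_assoc, ← Matrix.mul_assoc ιᵀ, hι, Matrix.one_mul]
  have hPs : Pᵀ = P := by simp [hP, Matrix.transpose_mul]
  have hPt : P.trace = m := by rw [hP, Matrix.trace_mul_comm, hι]; simp
  have hPmem : ∀ x, P.mulVec x ∈ V := fun x => by
    rw [← hr, hP, ← Matrix.mulVec_mulVec]; exact ⟨_, rfl⟩
  have hPfix : ∀ x ∈ V, P.mulVec x = x := fun x hx => by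
    rw [← hr] at hx
    obtain ⟨y, rfl⟩ := hx
    rw [Matrix.mulVecLin_apply, hP, Matrix.mulVec_mulVec, Matrix.mul_assoc, hι, Matrix.mul_one]
  -- the matrix is `s (n P - m)` with `s² n m (n - m) = 1`
  set s : ℝ := (Real.sqrt (n * m * (n - m)))⁻¹ with hs
  have hs2 : s ^ 2 * (n * m * (n - m)) = 1 := by
    rw [hs, inv_pow, Real.sq_sqrt (by positivity)]
    exact inv_mul_cancel₀ (by positivity)
  have hs0 : 0 < s := by rw [hs]; positivity
  let A : Matrix (Fin n) (Fin n) ℝ := s • ((n : ℝ) • P - (m : ℝ) • 1)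
  have hAx : ∀ x, A.mulVec x = (s * n) • P.mulVec x - (s * m) • x := fun x => by
    simp [A, Matrix.smul_mulVec, Matrix.sub_mulVec, smul_sub, smul_smul]
  let r : GeodesicRay n :=
    { g := 1
      A := A
      symm := by simp [Matrix.IsSymm, A, hPs]
      trace_zero := by simp [A, hPt]; right; ring
      unit_speed := by
        have : A * A = (s ^ 2 * (n ^ 2 - 2 * n * m)) • P + (s ^ 2 * m ^ 2) • 1 := by
          simp only [A, Matrix.smul_mul, Matrix.mul_smul, Matrix.sub_mul, Matrix.mul_sub, hPP,
            Matrix.mul_one, Matrix.one_mul]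
          module
        rw [this, Matrix.trace_add, Matrix.trace_smul, Matrix.trace_smul, hPt, Matrix.trace_one]
        simp only [smul_eq_mul, Fintype.card_fin]
        linear_combination hs2 }
  have hE : ∀ c, r.upperSpace c
      = ⨆ (μ : ℝ) (_ : c ≤ μ), Module.End.eigenspace (Matrix.toLin' A) μ := fun c => by
    simp [GeodesicRay.upperSpace, r]
  have hVa : V ≤ Module.End.eigenspace (Matrix.toLin' A) (s * (n - m)) := fun x hx => by
    rw [Module.End.mem_eigenspace_iff, Matrix.toLin'_apply, hAx, hPfix x hx]
    module
  have hker : ∀ x, x - P.mulVec x ∈ Module.End.eigenspace (Matrix.toLin' A) (-(s * m)) :=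
    fun x => by
    rw [Module.End.mem_eigenspace_iff, Matrix.toLin'_apply, hAx, Matrix.mulVec_sub,
      Matrix.mulVec_mulVec, hPP]
    module
  have heig : ∀ (μ : ℝ) (x : Fin n → ℝ), μ ≠ -(s * m) →
      x ∈ Module.End.eigenspace (Matrix.toLin' A) μ → x ∈ V := fun μ x hμ hx => by
    rw [Module.End.mem_eigenspace_iff, Matrix.toLin'_apply, hAx] at hx
    have h2 : (s * n) • P.mulVec x = (μ + s * m) • x := by
      rw [add_smul, ← hx]; module
    have h3 : μ + s * m ≠ 0 := fun h => hμ (by linarith)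
    have h4 : x = (μ + s * m)⁻¹ • (s * n) • P.mulVec x := by
      rw [h2, smul_smul, inv_mul_cancel₀ h3, one_smul]
    rw [h4]
    exact V.smul_mem _ (V.smul_mem _ (hPmem x))
  have heig2 : ∀ (μ : ℝ) (x : Fin n → ℝ), μ ≠ -(s * m) → μ ≠ s * (n - m) →
      x ∈ Module.End.eigenspace (Matrix.toLin' A) μ → x = 0 := fun μ x hμ hμ' hx => by
    have hxV := hVa (heig μ x hμ hx)
    rw [Module.End.mem_eigenspace_iff] at hx hxV
    rw [hx] at hxV
    have : (μ - s * (n - m)) • x = 0 := by rw [sub_smul, hxV, sub_self]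
    exact (smul_eq_zero.1 this).resolve_left (sub_ne_zero.2 hμ')
  have hlt : -(s * m) < s * (n - m) := by
    have : 0 < s * m := by positivity
    have : 0 < s * (n - m) := by positivity
    linarith
  have hle : ∀ c, -(s * m) < c → r.upperSpace c ≤ V := fun c hc => by
    rw [hE]
    exact iSup₂_le fun μ hμ x hx => heig μ x (by linarith) hx
  have hge : ∀ c, c ≤ s * (n - m) → V ≤ r.upperSpace c := fun c hc => by
    rw [hE]
    exact hVa.trans (le_iSup₂ (f := fun (μ : ℝ) (_ : c ≤ μ) =>
      Module.End.eigenspace (Matrix.toLin' A) μ) _ hc)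
  refine ⟨r.endpoint, r, rfl, ?_⟩
  ext U
  simp only [GeodesicRay.flag, Set.mem_ofPred_eq, Set.mem_singleton_iff]
  constructor
  · rintro ⟨⟨c, rfl⟩, hb, ht⟩
    rcases le_or_gt c (-(s * m)) with hc | hc
    · exfalso
      apply ht
      rw [eq_top_iff]
      intro x _
      have hx1 := hge c (by linarith) (hPmem x)
      have hx2 : x - P.mulVec x ∈ r.upperSpace c := by
        rw [hE]
        exact (le_iSup₂ (f := fun (μ : ℝ) (_ : c ≤ μ) =>
          Module.End.eigenspace (Matrix.toLin' A) μ) _ hc) (hker x)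
      simpa using Submodule.add_mem _ hx2 hx1
    · rcases le_or_gt c (s * (n - m)) with hc' | hc'
      · exact le_antisymm (hle c hc) (hge c hc')
      · exfalso
        apply hb
        rw [eq_bot_iff, hE]
        exact iSup₂_le fun μ hμ x hx => heig2 μ x (by linarith) (by linarith) hx
  · rintro rfl
    exact ⟨⟨s * (n - m), le_antisymm (hge _ le_rfl) (hle _ hlt)⟩, h0, h1⟩

end

/-! All four functions are expressed through one family, F_ι(X) = log det(ιᵀ X⁻¹ ι) (`logDetInv`),
where the columns of ι are a basis of a subspace of dimension m. Changing the basis adds a constant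
to F_ι, so differences of values depend on the subspace only.

The classical Busemann function of the vertex of V is c (F_ι(Y) - F_ι(X)) with 1/c = √(m(n - m)/n),
and this is found without computing the distance. From below, F_ι is 1/c-Lipschitz: its derivative
along a curve is, up to sign, the pairing of the traceless velocity with a projection of rank m, and
Cauchy-Schwarz applies after the trace part of the projection is removed (`trace_compress_sq_le`,
`logDetInv_sub_le`). A ray γ to the vertex realizes this slope, F_ι(γ(t)) = -t/c with its own basis,
whence d(γ(t), Y) ≥ t + c F_ι(Y). From above, `exists_riemDist_point_le` writes Y, seen from the
ray, as a unipotent translate of a point exp B in a flat through the ray. The translated flat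
segment has length √(t² - 2t tr(AB) + tr B²), and the unipotent element moves γ(t) by an
exponentially small amount. Since tr(AB) = -c F_ι(Y), both bounds agree in the limit.

The limit is the same for all rays of the class because every ray asymptotic to a vertex ray is
itself one with the same subspace (`GeodesicRay.IsVertexRay.exists_of_endpoint_eq`). Boundedness of
the distance forces growth rates on V that make the Cauchy-Schwarz inequality between the two
generators an equality.

On the Selberg side, the ratio of traces extends continuously to a boundary point [S] and equals
tr(Y⁻¹S)/tr(X⁻¹S) there (`tendsto_selbergRatio`). For S = vvᵀ its logarithm is the difference of
F_v, which is the first formula. In type k, π(X⁻¹) is ιᵀX⁻¹ι divided by the m-th root of its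
determinant with m = n - k, so F_v is corrected by -F_ι/m (`logDetInv_replicateCol_dualProj`), and
this correction is the second term. -/

noncomputable section

/-! ### Matrix calculus -/

open scoped Matrix.Norms.Operator in
/-- The exponential intertwines whatever its arguments intertwine. -/
theorem exp_mul_of_mul_eq {n m : ℕ} {A : Matrix (Fin n) (Fin n) ℝ} {B : Matrix (Fin m) (Fin m) ℝ}
    {K : Matrix (Fin n) (Fin m) ℝ} (h : A * K = K * B) :
    NormedSpace.exp A * K = K * NormedSpace.exp B := by
  have hp : ∀ j : ℕ, A ^ j * K = K * B ^ j := by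
    intro j
    induction j with
    | zero => simp
    | succ j ih => rw [pow_succ, pow_succ, Matrix.mul_assoc, h, ← Matrix.mul_assoc, ih,
        Matrix.mul_assoc]
  have h1 := (NormedSpace.exp_series_hasSum_exp' (𝕂 := ℝ) A).map
    (⟨⟨fun M => M * K, by simp⟩, fun a b => Matrix.add_mul a b K⟩ :
      Matrix (Fin n) (Fin n) ℝ →+ Matrix (Fin n) (Fin m) ℝ) (by
        change Continuous fun M : Matrix (Fin n) (Fin n) ℝ => M * K
        fun_prop)
  have h2 := (NormedSpace.exp_series_hasSum_exp' (𝕂 := ℝ) B).map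
    (⟨⟨fun M => K * M, by simp⟩, fun a b => Matrix.mul_add K a b⟩ :
      Matrix (Fin m) (Fin m) ℝ →+ Matrix (Fin n) (Fin m) ℝ) (by
        change Continuous fun M : Matrix (Fin m) (Fin m) ℝ => K * M
        fun_prop)
  refine h1.unique (HasSum.congr_fun h2 ?_)
  intro j
  simp [hp]

theorem hasDerivWithinAt_matrix {n m : ℕ} {c : ℝ → Matrix (Fin n) (Fin m) ℝ}
    {c' : Matrix (Fin n) (Fin m) ℝ} {s : Set ℝ} {t : ℝ} :
    HasDerivWithinAt c c' s t ↔ ∀ i j, HasDerivWithinAt (fun u => c u i j) (c' i j) s t := by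
  refine (hasDerivWithinAt_pi (φ := fun u i => c u i) (φ' := fun i => c' i)).trans ?_
  exact forall_congr' fun i => hasDerivWithinAt_pi (φ := fun u j => c u i j) (φ' := fun j => c' i j)

theorem HasDerivWithinAt.const_mul_mul_const {n m p q : ℕ} {c : ℝ → Matrix (Fin n) (Fin m) ℝ}
    {c' : Matrix (Fin n) (Fin m) ℝ} {s : Set ℝ} {t : ℝ} (h : HasDerivWithinAt c c' s t)
    (A : Matrix (Fin p) (Fin n) ℝ) (B : Matrix (Fin m) (Fin q) ℝ) :
    HasDerivWithinAt (fun u => A * c u * B) (A * c' * B) s t := by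
  rw [hasDerivWithinAt_matrix] at h ⊢
  intro i j
  simp only [Matrix.mul_apply]
  exact HasDerivWithinAt.fun_sum fun k _ =>
    (HasDerivWithinAt.fun_sum fun l _ => (h l k).const_mul _).mul_const _

/-- Jacobi's formula along a curve. -/
theorem hasDerivWithinAt_det {m : ℕ} {G : ℝ → Matrix (Fin m) (Fin m) ℝ}
    {G' : Matrix (Fin m) (Fin m) ℝ} {s : Set ℝ} {t : ℝ} (h : HasDerivWithinAt G G' s t) :
    HasDerivWithinAt (fun u => (G u).det) ((G t).adjugate * G').trace s t := by
  have hc : Continuous (Matrix.detRowAlternating (R := ℝ) (n := Fin m)) := by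
    change Continuous fun M : Matrix (Fin m) (Fin m) ℝ => M.det
    fun_prop
  -- As a multilinear function of the rows, the determinant has a derivative that replaces one row
  -- at a time; Cramer's rule turns these determinants into the adjugate.
  let d : ContinuousMultilinearMap ℝ (fun _ : Fin m => Fin m → ℝ) ℝ :=
    ⟨(Matrix.detRowAlternating (R := ℝ) (n := Fin m)).toMultilinearMap, hc⟩
  have h1 : HasDerivWithinAt (fun u i => (G u) i) (fun i => G' i) s t := by
    rw [hasDerivWithinAt_pi]
    intro i
    rw [hasDerivWithinAt_pi]
    exact fun j => hasDerivWithinAt_matrix.1 h i j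
  have h2 := (d.hasFDerivAt (G t)).comp_hasDerivWithinAt t h1
  refine h2.congr_deriv ?_
  refine (ContinuousMultilinearMap.linearDeriv_apply d (G t) (fun i => G' i)).trans ?_
  rw [Matrix.trace_mul_comm, Matrix.trace]
  refine Finset.sum_congr rfl fun i _ => ?_
  have h3 := Matrix.cramer_transpose_apply (G t) (G' i) i
  rw [Matrix.cramer_eq_adjugate_mulVec, ← Matrix.adjugate_transpose] at h3
  refine h3.symm.trans ?_
  simp [Matrix.mulVec, dotProduct, Matrix.mul_apply, mul_comm]

open scoped Matrix.Norms.Operator in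
theorem hasDerivWithinAt_matrix_inv {n : ℕ} {c : ℝ → Matrix (Fin n) (Fin n) ℝ}
    {c' : Matrix (Fin n) (Fin n) ℝ} {s : Set ℝ} {t : ℝ} (h : HasDerivWithinAt c c' s t)
    (hu : IsUnit (c t)) :
    HasDerivWithinAt (fun u => (c u)⁻¹) (-((c t)⁻¹ * c' * (c t)⁻¹)) s t := by
  obtain ⟨U, hU⟩ := hu
  have h1 := hasFDerivAt_ringInverse (𝕜 := ℝ) U
  rw [hU] at h1
  have h2 := h1.comp_hasDerivWithinAt t h
  simp only [Function.comp_def, ← Matrix.nonsing_inv_eq_ringInverse] at h2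
  refine h2.congr_deriv ?_
  have : (↑U⁻¹ : Matrix (Fin n) (Fin n) ℝ) = (c t)⁻¹ := by rw [← hU, Matrix.coe_units_inv]
  simp [this, Matrix.mul_assoc]

/-- The Frobenius pairing as a sum over entries. -/
theorem trace_mul_of_isSymm {n : ℕ} {A B : Matrix (Fin n) (Fin n) ℝ} (hA : A.IsSymm) :
    (A * B).trace = ∑ p : Fin n × Fin n, A p.1 p.2 * B p.1 p.2 := by
  refine Eq.trans ?_ (Fintype.sum_prod_type' fun i j => A i j * B i j).symm
  rw [Matrix.trace, Finset.sum_comm]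
  refine Finset.sum_congr rfl fun i _ => ?_
  rw [Matrix.diag_apply, Matrix.mul_apply]
  exact Finset.sum_congr rfl fun j _ => by rw [hA.apply]

theorem eq_zero_of_trace_mul_self_le {n : ℕ} {A : Matrix (Fin n) (Fin n) ℝ} (hA : A.IsSymm)
    (h : (A * A).trace ≤ 0) : A = 0 := by
  rw [trace_mul_of_isSymm hA] at h
  have h0 := (Finset.sum_eq_zero_iff_of_nonneg fun p _ => mul_self_nonneg _).1
    (le_antisymm h (Finset.sum_nonneg fun p _ => mul_self_nonneg _))
  ext i j
  exact mul_self_eq_zero.1 (h0 (i, j) (Finset.mem_univ _))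

theorem trace_mul_sq_le {n : ℕ} {A B : Matrix (Fin n) (Fin n) ℝ} (hA : A.IsSymm)
    (hB : B.IsSymm) : (A * B).trace ^ 2 ≤ (A * A).trace * (B * B).trace := by
  rw [trace_mul_of_isSymm hA, trace_mul_of_isSymm hA, trace_mul_of_isSymm hB]
  simpa only [pow_two] using Finset.sum_mul_sq_le_sq_mul_sq Finset.univ
    (fun p : Fin n × Fin n => A p.1 p.2) (fun p => B p.1 p.2)

theorem posDef_isSymm {n : ℕ} {A : Matrix (Fin n) (Fin n) ℝ} (hA : A.PosDef) : A.IsSymm := by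
  have h := hA.1
  rwa [Matrix.IsHermitian, Matrix.conjTranspose_eq_transpose_of_trivial] at h

/-- A traceless symmetric matrix pairs with a projection of rank `m` by at most
`√(m (n - m) / n)` times its norm. -/
theorem trace_projection_mul_sq_le {n : ℕ} {m : ℝ} (hn : 0 < n) {Q A : Matrix (Fin n) (Fin n) ℝ}
    (hQ : Q.IsSymm) (hQQ : Q * Q = Q) (hQt : Q.trace = m) (hA : A.IsSymm) (hA0 : A.trace = 0) :
    (Q * A).trace ^ 2 ≤ m * (n - m) / n * (A * A).trace := by
  have hn' : (n : ℝ) ≠ 0 := by positivity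
  -- The traceless part of Q: it has the same pairing with A, but the smaller squared norm m(n -
  -- m)/n, so Cauchy-Schwarz gives the sharp constant.
  set R : Matrix (Fin n) (Fin n) ℝ := Q - (m / n) • 1 with hR
  have hRs : R.IsSymm := by
    simp [Matrix.IsSymm, hR, hQ.eq]
  have h1 : (R * A).trace = (Q * A).trace := by
    simp [hR, Matrix.sub_mul, Matrix.trace_sub, hA0]
  have h2 : (R * R).trace = m * (n - m) / n := by
    simp only [hR, Matrix.sub_mul, Matrix.mul_sub, hQQ, Matrix.smul_mul, Matrix.mul_smul,
      Matrix.one_mul, Matrix.mul_one, Matrix.trace_sub, Matrix.trace_smul, hQt,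
      Matrix.trace_one, smul_eq_mul, Fintype.card_fin]
    field_simp
    ring
  have := trace_mul_sq_le hRs hA
  rwa [h1, h2] at this

/-- Orthogonal diagonalization of a real symmetric matrix. -/
theorem exists_orthogonal_diagonalization {n : ℕ} {A : Matrix (Fin n) (Fin n) ℝ}
    (hA : A.IsSymm) : ∃ (U : Matrix (Fin n) (Fin n) ℝ) (d : Fin n → ℝ),
      Uᵀ * U = 1 ∧ U * Uᵀ = 1 ∧ A = U * Matrix.diagonal d * Uᵀ := by
  have hH : A.IsHermitian := by
    rw [Matrix.IsHermitian, Matrix.conjTranspose_eq_transpose_of_trivial]; exact hA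
  have hs := hH.spectral_theorem
  rw [Unitary.conjStarAlgAut_apply, Matrix.star_eq_conjTranspose,
    Matrix.conjTranspose_eq_transpose_of_trivial] at hs
  have h1 := Unitary.mul_star_self_of_mem hH.eigenvectorUnitary.2
  have h2 := Unitary.star_mul_self_of_mem hH.eigenvectorUnitary.2
  rw [Matrix.star_eq_conjTranspose, Matrix.conjTranspose_eq_transpose_of_trivial] at h1 h2
  exact ⟨_, hH.eigenvalues, h2, h1, hs⟩

theorem exp_diagonal_real {n : ℕ} (d : Fin n → ℝ) :
    NormedSpace.exp (Matrix.diagonal d) = Matrix.diagonal fun i => Real.exp (d i) := by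
  rw [Matrix.exp_diagonal]
  congr 1
  ext i
  rw [Pi.coe_exp, ← Real.exp_eq_exp_ℝ]

theorem exp_orthogonal_conj {n : ℕ} {U : Matrix (Fin n) (Fin n) ℝ} (d : Fin n → ℝ)
    (h1 : Uᵀ * U = 1) (h2 : U * Uᵀ = 1) :
    NormedSpace.exp (U * Matrix.diagonal d * Uᵀ)
      = U * Matrix.diagonal (fun i => Real.exp (d i)) * Uᵀ := by
  have h : U * Matrix.diagonal d * Uᵀ * U = U * Matrix.diagonal d := by
    rw [Matrix.mul_assoc, h1, Matrix.mul_one]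
  rw [← exp_diagonal_real, ← exp_mul_of_mul_eq h, Matrix.mul_assoc (NormedSpace.exp _), h2,
    Matrix.mul_one]

theorem isSymm_conj_diagonal {n : ℕ} (U : Matrix (Fin n) (Fin n) ℝ) (d : Fin n → ℝ) :
    (U * Matrix.diagonal d * Uᵀ).IsSymm := by
  simp [Matrix.IsSymm, Matrix.transpose_mul, Matrix.mul_assoc]

/-- A positive definite matrix has a symmetric logarithm, which commutes with all that commutes
with the matrix. -/
theorem exists_log_of_posDef {n : ℕ} {D : Matrix (Fin n) (Fin n) ℝ} (hD : D.PosDef) :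
    ∃ B : Matrix (Fin n) (Fin n) ℝ, B.IsSymm ∧ NormedSpace.exp B = D ∧
      B.trace = Real.log D.det ∧ ∀ P, D * P = P * D → B * P = P * B := by
  obtain ⟨U, d, h1, h2, hU⟩ := exists_orthogonal_diagonalization (posDef_isSymm hD)
  have hd : ∀ i, 0 < d i := by
    have h : (Matrix.diagonal d).PosDef := by
      have h3 : Matrix.diagonal d = Uᵀ * D * U := by
        rw [hU, ← Matrix.mul_assoc, ← Matrix.mul_assoc, h1, Matrix.one_mul, Matrix.mul_assoc, h1,
          Matrix.mul_one]
      rw [h3, ← Matrix.conjTranspose_eq_transpose_of_trivial]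
      refine hD.conjTranspose_mul_mul_same (Matrix.mulVec_injective_of_isUnit ?_)
      exact IsUnit.of_mul_eq_one _ h2
    exact Matrix.posDef_diagonal_iff.1 h
  refine ⟨U * Matrix.diagonal (fun i => Real.log (d i)) * Uᵀ, isSymm_conj_diagonal _ _, ?_, ?_, ?_⟩
  · rw [exp_orthogonal_conj _ h1 h2, hU]
    simp [Real.exp_log (hd _)]
  · rw [hU, Matrix.trace_mul_comm, ← Matrix.mul_assoc, h1, Matrix.one_mul, Matrix.trace_diagonal,
      Matrix.det_mul_right_comm, h2, Matrix.one_mul,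
      Matrix.det_diagonal, Real.log_prod fun i _ => (hd i).ne']
  · intro P hP
    have h4 : Matrix.diagonal d * (Uᵀ * P * U) = Uᵀ * P * U * Matrix.diagonal d := by
      calc Matrix.diagonal d * (Uᵀ * P * U)
          = (Uᵀ * U) * Matrix.diagonal d * Uᵀ * P * U := by
            rw [h1, Matrix.one_mul]; simp only [Matrix.mul_assoc]
        _ = Uᵀ * (D * P) * U := by rw [hU]; simp only [Matrix.mul_assoc]
        _ = Uᵀ * P * U * Matrix.diagonal d * (Uᵀ * U) := by
            rw [hP, hU]; simp only [Matrix.mul_assoc]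
        _ = _ := by rw [h1, Matrix.mul_one]
    -- In the eigenbasis, commuting with D means that the (i, j) entry vanishes unless d i = d j,
    -- and then the logarithms agree as well.
    have h5 : Matrix.diagonal (fun i => Real.log (d i)) * (Uᵀ * P * U)
        = Uᵀ * P * U * Matrix.diagonal (fun i => Real.log (d i)) := by
      ext i j
      have h6 := congrFun (congrFun h4 i) j
      rw [Matrix.diagonal_mul, Matrix.mul_diagonal] at h6 ⊢
      rcases eq_or_ne ((Uᵀ * P * U) i j) 0 with h | h
      · rw [h]; ring
      · have : d i = d j := mul_right_cancel₀ h (by rw [h6, mul_comm])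
        rw [this, mul_comm]
    calc U * Matrix.diagonal (fun i => Real.log (d i)) * Uᵀ * P
        = U * Matrix.diagonal (fun i => Real.log (d i)) * Uᵀ * P * (U * Uᵀ) := by
          rw [h2, Matrix.mul_one]
      _ = U * (Matrix.diagonal (fun i => Real.log (d i)) * (Uᵀ * P * U)) * Uᵀ := by
          simp only [Matrix.mul_assoc]
      _ = (U * Uᵀ) * P * (U * Matrix.diagonal (fun i => Real.log (d i)) * Uᵀ) := by
          rw [h5]; simp only [Matrix.mul_assoc]
      _ = _ := by rw [h2, Matrix.one_mul]

/-! ### The Lipschitz bound for `log det (ιᵀ X⁻¹ ι)` -/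

/-- The function `log det (ιᵀ M⁻¹ ι)`. -/
def logDetInv {n m : ℕ} (ι : Matrix (Fin n) (Fin m) ℝ) (M : Matrix (Fin n) (Fin n) ℝ) : ℝ :=
  Real.log (ιᵀ * M⁻¹ * ι).det

theorem exists_eq_mul_transpose {n : ℕ} {M : Matrix (Fin n) (Fin n) ℝ} (hM : M.PosDef) :
    ∃ k : Matrix (Fin n) (Fin n) ℝ, M = k * kᵀ := by
  obtain ⟨B, hB, rfl, -, -⟩ := exists_log_of_posDef hM
  refine ⟨NormedSpace.exp ((1 / 2 : ℝ) • B), ?_⟩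
  rw [← Matrix.exp_transpose, Matrix.transpose_smul, hB.eq,
    ← Matrix.exp_add_of_commute _ _ (Commute.refl _), ← add_smul]
  norm_num

theorem posDef_compress {n m : ℕ} {ι : Matrix (Fin n) (Fin m) ℝ}
    (hι : Function.Injective ι.mulVec) {M : Matrix (Fin n) (Fin n) ℝ} (hM : M.PosDef) :
    (ιᵀ * M * ι).PosDef := by
  rw [← Matrix.conjTranspose_eq_transpose_of_trivial]
  exact hM.conjTranspose_mul_mul_same hι

theorem inv_mul_cancel_of_posDef {n : ℕ} {M : Matrix (Fin n) (Fin n) ℝ} (hM : M.PosDef) :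
    M⁻¹ * M = 1 :=
  Matrix.nonsing_inv_mul _ ((Matrix.isUnit_iff_isUnit_det _).1 hM.isUnit)

theorem mul_inv_cancel_of_posDef {n : ℕ} {M : Matrix (Fin n) (Fin n) ℝ} (hM : M.PosDef) :
    M * M⁻¹ = 1 :=
  Matrix.mul_nonsing_inv _ ((Matrix.isUnit_iff_isUnit_det _).1 hM.isUnit)

/-- Writing M⁻¹ = k kᵀ moves the tangent vector D to the traceless matrix kᵀDk at the identity,
whose Frobenius norm is the Riemannian norm of D. The left trace becomes its pairing with a
projection of rank m, so `trace_projection_mul_sq_le` applies. This is the infinitesimal Lipschitz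
bound for `logDetInv`. -/
theorem trace_compress_sq_le {n m : ℕ} (hn : 0 < n) {ι : Matrix (Fin n) (Fin m) ℝ}
    (hι : Function.Injective ι.mulVec) {M D : Matrix (Fin n) (Fin n) ℝ} (hM : M.PosDef)
    (hD : D.IsSymm) (h0 : (M⁻¹ * D).trace = 0) :
    ((ιᵀ * M⁻¹ * ι)⁻¹ * (ιᵀ * (M⁻¹ * D * M⁻¹) * ι)).trace ^ 2
      ≤ (m : ℝ) * (n - m) / n * (M⁻¹ * D * M⁻¹ * D).trace := by
  obtain ⟨k, hk⟩ := exists_eq_mul_transpose hM.inv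
  have hG := posDef_compress hι hM.inv
  have hG1 := inv_mul_cancel_of_posDef hG
  have hGs : ((ιᵀ * M⁻¹ * ι)⁻¹)ᵀ = (ιᵀ * M⁻¹ * ι)⁻¹ := posDef_isSymm hG.inv
  rw [hk] at hG1 hGs h0 ⊢
  set H := (ιᵀ * (k * kᵀ) * ι)⁻¹ with hH
  -- The orthogonal projection onto the column space of kᵀι.
  set Q := kᵀ * ι * H * ιᵀ * k with hQ
  have hQs : Q.IsSymm := by
    simp [Matrix.IsSymm, hQ, Matrix.transpose_mul, hGs, Matrix.mul_assoc]
  have hQQ : Q * Q = Q := by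
    calc Q * Q = kᵀ * ι * (H * (ιᵀ * (k * kᵀ) * ι)) * H * ιᵀ * k := by
          simp only [hQ, Matrix.mul_assoc]
      _ = Q := by rw [hG1, Matrix.mul_one]
  have hQt : Q.trace = m := by
    calc Q.trace = (kᵀ * ι * (H * ιᵀ * k)).trace := by simp only [hQ, Matrix.mul_assoc]
      _ = (H * (ιᵀ * (k * kᵀ) * ι)).trace := by
          rw [Matrix.trace_mul_comm]; simp only [Matrix.mul_assoc]
      _ = m := by rw [hG1]; simp
  have hDs : (kᵀ * D * k).IsSymm := by
    simp [Matrix.IsSymm, Matrix.transpose_mul, hD.eq, Matrix.mul_assoc]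
  have hD0 : (kᵀ * D * k).trace = 0 := by
    rw [← h0, Matrix.trace_mul_comm, ← Matrix.mul_assoc]
  have key := trace_projection_mul_sq_le hn hQs hQQ hQt hDs hD0
  have e1 : (Q * (kᵀ * D * k)).trace
      = (H * (ιᵀ * (k * kᵀ * D * (k * kᵀ)) * ι)).trace := by
    calc (Q * (kᵀ * D * k)).trace
        = (kᵀ * ι * (H * ιᵀ * k * (kᵀ * D * k))).trace := by simp only [hQ, Matrix.mul_assoc]
      _ = _ := by rw [Matrix.trace_mul_comm]; simp only [Matrix.mul_assoc]
  have e2 : (kᵀ * D * k * (kᵀ * D * k)).trace = (k * kᵀ * D * (k * kᵀ) * D).trace := by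
    calc (kᵀ * D * k * (kᵀ * D * k)).trace
        = (kᵀ * D * k * kᵀ * D * k).trace := by simp only [Matrix.mul_assoc]
      _ = _ := by rw [Matrix.trace_mul_comm]; simp only [Matrix.mul_assoc]
  rwa [e1, e2] at key

namespace C1Curve

variable {n : ℕ} {X Y : SymSpace n} (c : C1Curve X Y)

theorem hasDerivWithinAt {t : ℝ} (ht : t ∈ Set.Icc (0 : ℝ) 1) :
    HasDerivWithinAt c.curve (c.vel t) (Set.Icc 0 1) t :=
  hasDerivWithinAt_matrix.2 (c.hasDeriv t ht)

/-- The curve has symmetric values, and derivatives within [0, 1] are unique, also at the end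
points. -/
theorem vel_isSymm {t : ℝ} (ht : t ∈ Set.Icc (0 : ℝ) 1) : (c.vel t).IsSymm := by
  ext i j
  refine UniqueDiffWithinAt.eq_deriv _ ((uniqueDiffOn_Icc zero_lt_one) t ht)
    (c.hasDeriv t ht j i) ((c.hasDeriv t ht i j).congr ?_ ?_)
  · exact fun u hu => (posDef_isSymm (c.mem u hu).1).apply i j
  · exact (posDef_isSymm (c.mem t ht).1).apply i j

/-- Jacobi's formula for the constant determinant 1; the adjugate is then the inverse. -/
theorem trace_inv_mul_vel {t : ℝ} (ht : t ∈ Set.Icc (0 : ℝ) 1) :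
    ((c.curve t)⁻¹ * c.vel t).trace = 0 := by
  have h1 := hasDerivWithinAt_det (c.hasDerivWithinAt ht)
  have h2 : HasDerivWithinAt (fun u => (c.curve u).det) 0 (Set.Icc 0 1) t :=
    (hasDerivWithinAt_const t _ (1 : ℝ)).congr (fun u hu => (c.mem u hu).2) (c.mem t ht).2
  have h3 := UniqueDiffWithinAt.eq_deriv _ ((uniqueDiffOn_Icc zero_lt_one) t ht) h1 h2
  rw [Matrix.inv_def, (c.mem t ht).2, Ring.inverse_one, one_smul, h3]

theorem continuousOn_speed : ContinuousOn (fun t =>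
    Real.sqrt (((c.curve t)⁻¹ * c.vel t * (c.curve t)⁻¹ * c.vel t).trace)) (Set.Icc 0 1) := by
  have hi : ContinuousOn (fun t => (c.curve t)⁻¹) (Set.Icc 0 1) := by
    intro t ht
    have h := hasDerivWithinAt_matrix_inv (c.hasDerivWithinAt ht) (c.mem t ht).1.isUnit
    rw [hasDerivWithinAt_matrix] at h
    exact continuousWithinAt_pi.2 fun i => continuousWithinAt_pi.2 fun j =>
      (h i j).continuousWithinAt
  have hv := c.vel_cont
  have h2 : ContinuousOn (fun t => (c.curve t)⁻¹ * c.vel t * (c.curve t)⁻¹ * c.vel t)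
    (Set.Icc 0 1) := ((ContinuousOn.mul hi hv).mul hi).mul hv
  have h3 : Continuous fun M : Matrix (Fin n) (Fin n) ℝ => Real.sqrt M.trace := by fun_prop
  exact h3.comp_continuousOn h2

theorem length_nonneg : 0 ≤ c.length :=
  intervalIntegral.integral_nonneg zero_le_one fun _ _ => Real.sqrt_nonneg _

theorem logDetInv_sub_le {m : ℕ} {ι : Matrix (Fin n) (Fin m) ℝ} (hn : 0 < n)
    (hmn : m ≤ n) (hι : Function.Injective ι.mulVec) :
    logDetInv ι Y.mat - logDetInv ι X.mat ≤ Real.sqrt ((m : ℝ) * (n - m) / n) * c.length := by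
  rw [← c.source, ← c.target]
  have hder : ∀ t ∈ Set.Icc (0 : ℝ) 1, HasDerivWithinAt (fun u => logDetInv ι (c.curve u))
      (-((ιᵀ * (c.curve t)⁻¹ * ι)⁻¹ *
        (ιᵀ * ((c.curve t)⁻¹ * c.vel t * (c.curve t)⁻¹) * ι)).trace) (Set.Icc 0 1) t := by
    intro t ht
    have hG := posDef_compress hι (c.mem t ht).1.inv
    have h1 := (hasDerivWithinAt_matrix_inv (c.hasDerivWithinAt ht)
      (c.mem t ht).1.isUnit).const_mul_mul_const ιᵀ ι
    have h2 := (hasDerivWithinAt_det h1).log hG.det_pos.ne'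
    refine h2.congr_deriv ?_
    rw [Matrix.inv_def (ιᵀ * (c.curve t)⁻¹ * ι), Ring.inverse_eq_inv']
    simp [Matrix.trace_smul, div_eq_inv_mul]
  -- In this form of the fundamental theorem only the dominating function, here a multiple of the
  -- continuous speed, has to be integrable.
  have key := intervalIntegral.sub_le_integral_of_hasDeriv_right_of_le (zero_le_one' ℝ)
    (fun t ht => (hder t ht).continuousWithinAt)
    (fun t ht => (hder t (Set.Ioo_subset_Icc_self ht)).mono_of_mem_nhdsWithin
      (mem_nhdsWithin_of_mem_nhds (Icc_mem_nhds ht.1 ht.2)))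
    ((continuousOn_const.mul c.continuousOn_speed).integrableOn_Icc (μ := MeasureTheory.volume))
    (φ := fun t => Real.sqrt ((m : ℝ) * (n - m) / n) *
      Real.sqrt (((c.curve t)⁻¹ * c.vel t * (c.curve t)⁻¹ * c.vel t).trace)) ?_
  · rwa [intervalIntegral.integral_const_mul] at key
  · intro t ht
    have ht' := Set.Ioo_subset_Icc_self ht
    have h1 := trace_compress_sq_le hn hι (c.mem t ht').1 (c.vel_isSymm ht')
      (c.trace_inv_mul_vel ht')
    have h2 := Real.sqrt_le_sqrt h1
    rw [Real.sqrt_sq_eq_abs] at h2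
    refine (neg_le_abs _).trans (h2.trans ?_)
    rw [Real.sqrt_mul]
    have : (m : ℝ) ≤ n := by exact_mod_cast hmn
    have : (0 : ℝ) ≤ n - m := by linarith
    positivity

end C1Curve

theorem JoinedBy.nonneg {n : ℕ} {X Y : SymSpace n} {L : ℝ} (h : JoinedBy X Y L) : 0 ≤ L := by
  induction h with
  | single c => exact c.length_nonneg
  | concat _ _ h1 h2 => exact add_nonneg h1 h2

theorem JoinedBy.logDetInv_sub_le {n m : ℕ} {ι : Matrix (Fin n) (Fin m) ℝ} (hn : 0 < n)
    (hmn : m ≤ n) (hι : Function.Injective ι.mulVec) {X Y : SymSpace n} {L : ℝ}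
    (h : JoinedBy X Y L) :
    logDetInv ι Y.mat - logDetInv ι X.mat ≤ Real.sqrt ((m : ℝ) * (n - m) / n) * L := by
  induction h with
  | single c => exact c.logDetInv_sub_le hn hmn hι
  | concat _ _ h1 h2 => linarith

theorem JoinedBy.riemEDist_le {n : ℕ} {X Y : SymSpace n} {L : ℝ} (h : JoinedBy X Y L) :
    riemEDist X Y ≤ ENNReal.ofReal L := iInf₂_le L h

theorem JoinedBy.riemDist_le {n : ℕ} {X Y : SymSpace n} {L : ℝ} (h : JoinedBy X Y L) :
    riemDist X Y ≤ L := ENNReal.toReal_le_of_le_ofReal h.nonneg h.riemEDist_le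

/-- Finiteness is essential: the real-valued distance would be 0 if the infimum were infinite. -/
theorem exists_joinedBy_lt {n : ℕ} {X Y : SymSpace n} (h : riemEDist X Y ≠ ⊤) {d : ℝ}
    (hd : riemDist X Y < d) : ∃ L < d, JoinedBy X Y L := by
  have h1 : riemEDist X Y < ENNReal.ofReal d := by
    rw [← ENNReal.ofReal_toReal h]
    exact (ENNReal.ofReal_lt_ofReal_iff (ENNReal.toReal_nonneg.trans_lt hd)).2 hd
  rw [riemEDist] at h1
  simp only [iInf_lt_iff] at h1
  obtain ⟨L, hL, h2⟩ := h1
  exact ⟨L, (ENNReal.ofReal_lt_ofReal_iff_of_nonneg hL.nonneg).1 h2, hL⟩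

/-- No minimizing curve is needed: the bound holds for curves of length below any d greater than the
distance, and d then decreases to the distance. -/
theorem logDetInv_sub_le_of_ne_top {n m : ℕ} {ι : Matrix (Fin n) (Fin m) ℝ} (hn : 0 < n)
    (hmn : m ≤ n) (hι : Function.Injective ι.mulVec) {X Y : SymSpace n}
    (h : riemEDist X Y ≠ ⊤) :
    logDetInv ι Y.mat - logDetInv ι X.mat ≤
      Real.sqrt ((m : ℝ) * (n - m) / n) * riemDist X Y := by
  have h1 : Tendsto (fun d : ℝ => Real.sqrt ((m : ℝ) * (n - m) / n) * d)
      (𝓝[>] (riemDist X Y)) (𝓝 (Real.sqrt ((m : ℝ) * (n - m) / n) * riemDist X Y)) :=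
    ((continuous_const.mul continuous_id).tendsto _).mono_left nhdsWithin_le_nhds
  refine ge_of_tendsto h1 (eventually_nhdsWithin_of_forall fun d hd => ?_)
  obtain ⟨L, hL, hJ⟩ := exists_joinedBy_lt h hd
  exact (hJ.logDetInv_sub_le hn hmn hι).trans
    (mul_le_mul_of_nonneg_left hL.le (Real.sqrt_nonneg _))

/-! ### Explicit curves -/

theorem joinedBy_of_constant_speed {n : ℕ} {X Y : SymSpace n}
    {c v : ℝ → Matrix (Fin n) (Fin n) ℝ} {L : ℝ}
    (mem : ∀ t, (c t).PosDef ∧ (c t).det = 1)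
    (hder : ∀ t, HasDerivWithinAt c (v t) (Set.Icc 0 1) t) (hv : Continuous v)
    (hX : c 0 = X.mat) (hY : c 1 = Y.mat)
    (hL : ∀ t, ((c t)⁻¹ * v t * (c t)⁻¹ * v t).trace = L) : JoinedBy X Y (Real.sqrt L) := by
  let d : C1Curve X Y :=
    { curve := c
      vel := v
      mem := fun t _ => mem t
      hasDeriv := fun t _ => hasDerivWithinAt_matrix.1 (hder t)
      vel_cont := hv.continuousOn
      source := hX
      target := hY }
  have h : d.length = Real.sqrt L := by simp [C1Curve.length, d, hL]
  exact h ▸ JoinedBy.single d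

theorem posDef_and_det_conj {n : ℕ} {M g : Matrix (Fin n) (Fin n) ℝ}
    (hM : M.PosDef ∧ M.det = 1) (hg : g.det = 1) :
    (gᵀ * M * g).PosDef ∧ (gᵀ * M * g).det = 1 := by
  constructor
  · refine posDef_compress (Matrix.mulVec_injective_of_isUnit ?_) hM.1
    rw [Matrix.isUnit_iff_isUnit_det, hg]
    exact isUnit_one
  · simp [hg, hM.2]

/-- The isometric action `g.X = gᵀ X g`. -/
def SymSpace.act {n : ℕ} (g : Matrix.SpecialLinearGroup (Fin n) ℝ) (X : SymSpace n) :
    SymSpace n :=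
  ⟨(g : Matrix (Fin n) (Fin n) ℝ)ᵀ * X.mat * g, posDef_and_det_conj X.2 g.2⟩

theorem JoinedBy.act {n : ℕ} (g : Matrix.SpecialLinearGroup (Fin n) ℝ) {X Y : SymSpace n}
    {L : ℝ} (h : JoinedBy X Y L) : JoinedBy (X.act g) (Y.act g) L := by
  induction h with
  | @single X Y c =>
    let d : C1Curve (X.act g) (Y.act g) :=
      { curve := fun t => (g : Matrix (Fin n) (Fin n) ℝ)ᵀ * c.curve t * g
        vel := fun t => (g : Matrix (Fin n) (Fin n) ℝ)ᵀ * c.vel t * g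
        mem := fun t ht => posDef_and_det_conj (c.mem t ht) g.2
        hasDeriv := fun t ht => hasDerivWithinAt_matrix.1
          ((c.hasDerivWithinAt ht).const_mul_mul_const _ _)
        vel_cont := (continuousOn_const.mul c.vel_cont).mul continuousOn_const
        source := by rw [c.source]; rfl
        target := by rw [c.target]; rfl }
    have hl : d.length = c.length := by
      refine intervalIntegral.integral_congr fun t _ => ?_
      set G : Matrix (Fin n) (Fin n) ℝ := ↑g with hG
      have hu : IsUnit G.det := by rw [hG, g.2]; exact isUnit_one
      have hu' : IsUnit Gᵀ.det := by rwa [Matrix.det_transpose]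
      -- The action only conjugates the logarithmic velocity by G, which leaves the trace of its
      -- square unchanged.
      have e : (d.curve t)⁻¹ * d.vel t = G⁻¹ * ((c.curve t)⁻¹ * c.vel t) * G := by
        change (Gᵀ * c.curve t * G)⁻¹ * (Gᵀ * c.vel t * G) = _
        rw [Matrix.mul_inv_rev, Matrix.mul_inv_rev]
        calc G⁻¹ * ((c.curve t)⁻¹ * Gᵀ⁻¹) * (Gᵀ * c.vel t * G)
            = G⁻¹ * (c.curve t)⁻¹ * (Gᵀ⁻¹ * Gᵀ) * c.vel t * G := by
              simp only [Matrix.mul_assoc]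
          _ = _ := by rw [Matrix.nonsing_inv_mul _ hu']; simp only [Matrix.mul_assoc, Matrix.one_mul]
      change Real.sqrt _ = Real.sqrt _
      rw [Matrix.mul_assoc _ (d.curve t)⁻¹, e, Matrix.mul_assoc _ (c.curve t)⁻¹]
      congr 1
      calc (G⁻¹ * ((c.curve t)⁻¹ * c.vel t) * G * (G⁻¹ * ((c.curve t)⁻¹ * c.vel t) * G)).trace
          = (G⁻¹ * ((c.curve t)⁻¹ * c.vel t) * (G * G⁻¹) * ((c.curve t)⁻¹ * c.vel t) * G).trace := by
            simp only [Matrix.mul_assoc]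
        _ = _ := by
            rw [Matrix.mul_nonsing_inv _ hu, Matrix.mul_one, Matrix.trace_mul_comm]
            simp only [← Matrix.mul_assoc, Matrix.mul_nonsing_inv _ hu, Matrix.one_mul]
    exact hl ▸ JoinedBy.single d
  | concat _ _ h1 h2 => exact JoinedBy.concat h1 h2

/-- The point `exp B`. -/
def expPoint {n : ℕ} (B : Matrix (Fin n) (Fin n) ℝ) (hB : B.IsSymm) (h0 : B.trace = 0) :
    SymSpace n := ⟨NormedSpace.exp B, posDef_exp hB, det_exp_eq_one hB h0⟩

theorem exp_inv_mul_exp {n : ℕ} (B : Matrix (Fin n) (Fin n) ℝ) :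
    (NormedSpace.exp B)⁻¹ * NormedSpace.exp B = 1 :=
  Matrix.nonsing_inv_mul _ ((Matrix.isUnit_iff_isUnit_det _).1 (Matrix.isUnit_exp B))

open scoped Matrix.Norms.Operator in
theorem hasDerivWithinAt_exp_smul {n : ℕ} (A : Matrix (Fin n) (Fin n) ℝ) (s : Set ℝ) (t : ℝ) :
    HasDerivWithinAt (fun u : ℝ => NormedSpace.exp (u • A)) (NormedSpace.exp (t • A) * A) s t :=
  (hasDerivAt_exp_smul_const (𝕂 := ℝ) A t).hasDerivWithinAt

open scoped Matrix.Norms.Operator in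
theorem continuous_exp_smul {n : ℕ} (A : Matrix (Fin n) (Fin n) ℝ) :
    Continuous fun u : ℝ => NormedSpace.exp (u • A) :=
  continuous_iff_continuousAt.2 fun t => (hasDerivAt_exp_smul_const (𝕂 := ℝ) A t).continuousAt

/-- Commuting matrices span a flat: along exp(B + t(C - B)) the logarithmic velocity is constantly C
- B. -/
theorem joinedBy_exp {n : ℕ} {B C : Matrix (Fin n) (Fin n) ℝ} (hB : B.IsSymm)
    (hB0 : B.trace = 0) (hC : C.IsSymm) (hC0 : C.trace = 0) (hBC : Commute B C) :
    JoinedBy (expPoint B hB hB0) (expPoint C hC hC0)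
      (Real.sqrt ((C - B) * (C - B)).trace) := by
  have hc : ∀ t : ℝ, NormedSpace.exp (B + t • (C - B))
      = NormedSpace.exp B * NormedSpace.exp (t • (C - B)) := fun t =>
    Matrix.exp_add_of_commute _ _ ((hBC.sub_right (Commute.refl B)).smul_right t)
  have hmem : ∀ t : ℝ, (NormedSpace.exp (B + t • (C - B))).PosDef ∧
      (NormedSpace.exp (B + t • (C - B))).det = 1 := fun t =>
    ⟨posDef_exp (hB.add ((hC.sub hB).smul t)),
      det_exp_eq_one (hB.add ((hC.sub hB).smul t)) (by simp [hB0, hC0])⟩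
  refine joinedBy_of_constant_speed (c := fun t => NormedSpace.exp (B + t • (C - B)))
    (v := fun t => NormedSpace.exp (B + t • (C - B)) * (C - B)) hmem ?_ ?_ ?_ ?_ ?_
  · intro t
    have h := (hasDerivWithinAt_exp_smul (C - B) (Set.Icc 0 1) t).const_mul_mul_const
      (NormedSpace.exp B) (1 : Matrix (Fin n) (Fin n) ℝ)
    simpa only [hc, Matrix.mul_one, Matrix.mul_assoc] using h
  · simp only [hc]
    exact (continuous_const.mul (continuous_exp_smul _)).mul continuous_const
  · simp [expPoint, SymSpace.mat]
  · simp [expPoint, SymSpace.mat]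
  · intro t
    have h := exp_inv_mul_exp (B + t • (C - B))
    rw [← Matrix.mul_assoc (NormedSpace.exp _)⁻¹, h, Matrix.one_mul, Matrix.mul_assoc,
      ← Matrix.mul_assoc (NormedSpace.exp _)⁻¹, h, Matrix.one_mul]

theorem one_add_smul_mul_one_sub_smul {n : ℕ} {N : Matrix (Fin n) (Fin n) ℝ} (hN : N * N = 0)
    (t : ℝ) : (1 + t • N) * (1 - t • N) = 1 := by
  simp [Matrix.add_mul, Matrix.mul_sub, hN]

open scoped Matrix.Norms.Operator in
/-- A shear `X ↦ (1 + N)ᵀ X (1 + N)` moves a point which contracts `Nᵀ` a short way. -/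
theorem joinedBy_shear {n : ℕ} {X Y : SymSpace n} {N : Matrix (Fin n) (Fin n) ℝ} {δ : ℝ}
    (hN : N * N = 0) (hdet : ∀ t : ℝ, (1 + t • N).det = 1)
    (hδ : Nᵀ * X.mat = δ • (X.mat * Nᵀ)) (hY : Y.mat = (1 + N)ᵀ * X.mat * (1 + N)) :
    JoinedBy X Y (Real.sqrt (2 * δ * (N * Nᵀ).trace)) := by
  set E := X.mat with hE
  have hNT : Nᵀ * Nᵀ = 0 := by rw [← Matrix.transpose_mul, hN, Matrix.transpose_zero]
  -- With this factorization the logarithmic velocity is the conjugate of the constant matrix δNᵀ +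
  -- N by 1 + tN. As N and Nᵀ square to zero, only the cross terms remain in the trace of the
  -- square, and these carry the factor δ.
  have hv : ∀ t : ℝ, Nᵀ * E * (1 + t • N) + (1 + t • N)ᵀ * E * N
      = (1 + t • N)ᵀ * E * ((δ • Nᵀ + N) * (1 + t • N)) := by
    intro t
    have e1 : (1 + t • N)ᵀ * Nᵀ = Nᵀ := by
      simp [Matrix.add_mul, hNT]
    have e2 : N * (1 + t • N) = N := by simp [Matrix.mul_add, hN]
    have e3 : (1 + t • N)ᵀ * E * (δ • Nᵀ) = Nᵀ * E := by
      rw [Matrix.mul_assoc, Matrix.mul_smul, ← hδ, ← Matrix.mul_assoc, e1]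
    rw [Matrix.add_mul (δ • Nᵀ), Matrix.mul_add ((1 + t • N)ᵀ * E), ← Matrix.mul_assoc _ (δ • Nᵀ), e3, e2]
  refine joinedBy_of_constant_speed (c := fun t => (1 + t • N)ᵀ * E * (1 + t • N))
    (v := fun t => Nᵀ * E * (1 + t • N) + (1 + t • N)ᵀ * E * N)
    (fun t => posDef_and_det_conj X.2 (hdet t)) ?_ ?_ ?_ ?_ ?_
  · intro t
    have hw : HasDerivWithinAt (fun u : ℝ => 1 + u • N) N (Set.Icc 0 1) t := by
      exact (((hasDerivWithinAt_id t (Set.Icc (0 : ℝ) 1)).smul_const N).const_add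
        (1 : Matrix (Fin n) (Fin n) ℝ)).congr_deriv (one_smul ℝ N)
    have hwT : HasDerivWithinAt (fun u : ℝ => (1 + u • N)ᵀ) Nᵀ (Set.Icc 0 1) t :=
      hasDerivWithinAt_matrix.2 fun i j => hasDerivWithinAt_matrix.1 hw j i
    exact (HasDerivWithinAt.mul_const hwT E).mul hw
  · fun_prop
  · simp [hE]
  · simpa using hY.symm
  · intro t
    have hu := one_add_smul_mul_one_sub_smul hN t
    have hinv := Matrix.inv_eq_right_inv hu
    have hE1 := inv_mul_cancel_of_posDef X.2.1
    have hdT : ((1 + t • N)ᵀ)⁻¹ * (1 + t • N)ᵀ = 1 :=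
      Matrix.nonsing_inv_mul _ (by rw [Matrix.det_transpose, hdet]; exact isUnit_one)
    have hcv : ((1 + t • N)ᵀ * E * (1 + t • N))⁻¹ *
        (Nᵀ * E * (1 + t • N) + (1 + t • N)ᵀ * E * N)
        = (1 - t • N) * (δ • Nᵀ + N) * (1 + t • N) := by
      rw [hv, Matrix.mul_inv_rev, Matrix.mul_inv_rev, hinv]
      calc (1 - t • N) * (E⁻¹ * ((1 + t • N)ᵀ)⁻¹) *
            ((1 + t • N)ᵀ * E * ((δ • Nᵀ + N) * (1 + t • N)))
          = (1 - t • N) * (E⁻¹ * ((((1 + t • N)ᵀ)⁻¹ * (1 + t • N)ᵀ) * E)) *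
            ((δ • Nᵀ + N) * (1 + t • N)) := by simp only [Matrix.mul_assoc]
        _ = _ := by
          rw [hdT, Matrix.one_mul, hE]
          change (1 - t • N) * (X.1⁻¹ * X.1) * _ = _
          rw [hE1, Matrix.mul_one, Matrix.mul_assoc]
    rw [Matrix.mul_assoc _ (((1 + t • N)ᵀ * E * (1 + t • N))⁻¹), hcv]
    calc ((1 - t • N) * (δ • Nᵀ + N) * (1 + t • N) *
          ((1 - t • N) * (δ • Nᵀ + N) * (1 + t • N))).trace
        = ((1 - t • N) * ((δ • Nᵀ + N) * ((1 + t • N) * (1 - t • N)) * (δ • Nᵀ + N) *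
            (1 + t • N))).trace := by simp only [Matrix.mul_assoc]
      _ = ((δ • Nᵀ + N) * (δ • Nᵀ + N)).trace := by
          rw [hu, Matrix.mul_one, Matrix.trace_mul_comm, Matrix.mul_assoc, hu, Matrix.mul_one]
      _ = 2 * δ * (N * Nᵀ).trace := by
          rw [Matrix.add_mul, Matrix.mul_add, Matrix.mul_add]
          simp only [Matrix.smul_mul, Matrix.mul_smul, hN, hNT, Matrix.trace_add,
            Matrix.trace_smul, smul_zero, Matrix.trace_zero, smul_eq_mul]
          rw [Matrix.trace_mul_comm Nᵀ N]
          ring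

/-! ### Finiteness of the distance and the Lipschitz bound -/

theorem exists_eq_expPoint {n : ℕ} (X : SymSpace n) :
    ∃ (B : Matrix (Fin n) (Fin n) ℝ) (hB : B.IsSymm) (h0 : B.trace = 0),
      X = expPoint B hB h0 := by
  obtain ⟨B, hB, he, ht, -⟩ := exists_log_of_posDef X.2.1
  rw [X.2.2, Real.log_one] at ht
  exact ⟨B, hB, ht, Subtype.ext he.symm⟩

/-- Every point is an exponential and is therefore joined to exp 0 by a curve of finite length. -/
theorem riemEDist_ne_top {n : ℕ} (X Y : SymSpace n) : riemEDist X Y ≠ ⊤ := by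
  have h : ∀ Z : SymSpace n,
      riemEDist (expPoint 0 Matrix.isSymm_zero (Matrix.trace_zero _ _)) Z ≠ ⊤ := by
    intro Z
    obtain ⟨B, hB, h0, rfl⟩ := exists_eq_expPoint Z
    exact ((joinedBy_exp _ _ hB h0 (Commute.zero_left B)).riemEDist_le.trans_lt
      ENNReal.ofReal_lt_top).ne
  refine ((riemEDist_triangle X (expPoint 0 Matrix.isSymm_zero (Matrix.trace_zero _ _)) Y).trans_lt
    (ENNReal.add_lt_top.2 ⟨?_, (h Y).lt_top⟩)).ne
  rw [riemEDist_comm]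
  exact (h X).lt_top

theorem logDetInv_sub_le {n m : ℕ} {ι : Matrix (Fin n) (Fin m) ℝ} (hn : 0 < n)
    (hmn : m ≤ n) (hι : Function.Injective ι.mulVec) (X Y : SymSpace n) :
    logDetInv ι Y.mat - logDetInv ι X.mat ≤
      Real.sqrt ((m : ℝ) * (n - m) / n) * riemDist X Y :=
  logDetInv_sub_le_of_ne_top hn hmn hι (riemEDist_ne_top X Y)

theorem riemDist_comm {n : ℕ} (X Y : SymSpace n) : riemDist X Y = riemDist Y X := by
  rw [riemDist, riemEDist_comm, riemDist]

/-! ### Rays pointing to a vertex -/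

theorem exp_smul_one {m : ℕ} (a : ℝ) :
    NormedSpace.exp (a • (1 : Matrix (Fin m) (Fin m) ℝ)) = Real.exp a • 1 := by
  have h := exp_diagonal_real (fun _ : Fin m => a)
  rwa [← Matrix.smul_one_eq_diagonal, ← Matrix.smul_one_eq_diagonal] at h

/-- On the ranges of P and 1 - P the exponent acts by the scalars a + c and a. -/
theorem exp_add_projection {n : ℕ} {P : Matrix (Fin n) (Fin n) ℝ} (hP : P * P = P) (a c : ℝ) :
    NormedSpace.exp (a • 1 + c • P) = Real.exp a • (1 - P) + Real.exp (a + c) • P := by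
  have h1 : (a • 1 + c • P) * P = P * ((a + c) • 1) := by
    simp [Matrix.add_mul, Matrix.mul_add, hP, add_smul]
  have h2 : (a • 1 + c • P) * (1 - P) = (1 - P) * (a • 1) := by
    simp [Matrix.add_mul, Matrix.mul_sub, hP, smul_sub]
  have e1 := exp_mul_of_mul_eq h1
  have e2 := exp_mul_of_mul_eq h2
  rw [exp_smul_one] at e1 e2
  calc NormedSpace.exp (a • 1 + c • P)
      = NormedSpace.exp (a • 1 + c • P) * (1 - P) + NormedSpace.exp (a • 1 + c • P) * P := by
        rw [← Matrix.mul_add, sub_add_cancel, Matrix.mul_one]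
    _ = _ := by rw [e1, e2]; simp

theorem det_exp_of_isSymm {n : ℕ} {B : Matrix (Fin n) (Fin n) ℝ} (hB : B.IsSymm) :
    (NormedSpace.exp B).det = Real.exp B.trace := by
  obtain ⟨U, d, h1, h2, rfl⟩ := exists_orthogonal_diagonalization hB
  rw [exp_orthogonal_conj d h1 h2, Matrix.det_mul_right_comm, h2, Matrix.one_mul,
    Matrix.det_diagonal, Matrix.trace_mul_comm, ← Matrix.mul_assoc, h1, Matrix.one_mul,
    Matrix.trace_diagonal, Real.exp_sum]

theorem injective_of_frame {n m : ℕ} {κ : Matrix (Fin n) (Fin m) ℝ} (hκ : κᵀ * κ = 1) :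
    Function.Injective κ.mulVec := by
  intro x y hxy
  have := congrArg (κᵀ).mulVec hxy
  simpa [Matrix.mulVec_mulVec, hκ] using this

/-- Block triangular decomposition of a positive definite matrix along an orthonormal frame. -/
theorem exists_block_decomposition {n m : ℕ} {κ : Matrix (Fin n) (Fin m) ℝ} (hκ : κᵀ * κ = 1)
    {Y : Matrix (Fin n) (Fin n) ℝ} (hY : Y.PosDef) :
    ∃ N D : Matrix (Fin n) (Fin n) ℝ, κ * κᵀ * N = 0 ∧ N * (κ * κᵀ) = N ∧ D.PosDef ∧
      D * κ = κ * (κᵀ * Y⁻¹ * κ)⁻¹ ∧ D * (κ * κᵀ) = κ * κᵀ * D ∧ Y = (1 + N)ᵀ * D * (1 + N) := by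
  have hG := posDef_compress (injective_of_frame hκ) hY.inv
  set G := κᵀ * Y⁻¹ * κ with hGdef
  have hG1 := mul_inv_cancel_of_posDef hG
  have hGs : (G⁻¹)ᵀ = G⁻¹ := posDef_isSymm hG.inv
  set R := κ * G⁻¹ * κᵀ with hR
  have hRs : Rᵀ = R := by simp [hR, Matrix.transpose_mul, hGs, Matrix.mul_assoc]
  set P := κ * κᵀ with hP
  have hPs : Pᵀ = P := by simp [hP, Matrix.transpose_mul]
  have hPκ : P * κ = κ := by rw [hP, Matrix.mul_assoc, hκ, Matrix.mul_one]
  have hκP : κᵀ * P = κᵀ := by rw [hP, ← Matrix.mul_assoc, hκ, Matrix.one_mul]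
  have hPP : P * P = P := by rw [← Matrix.mul_assoc P, hPκ]
  have hPR : P * R = R := by rw [hR, ← Matrix.mul_assoc, ← Matrix.mul_assoc, hPκ]
  have hRP : R * P = R := by rw [hR, Matrix.mul_assoc, hκP]
  -- Chosen so that (1 - N)P = Y⁻¹R, hence Y(1 - N)P = R, whose range lies in that of P: this clears
  -- the off-diagonal blocks of (1 - N)ᵀY(1 - N). The inverse in R makes P Y⁻¹ R = P, hence PN = 0.
  set N := P - Y⁻¹ * R with hN
  have hPN : P * N = 0 := by
    have : P * (Y⁻¹ * R) = P := by
      calc P * (Y⁻¹ * R) = κ * (G * G⁻¹) * κᵀ := by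
            simp only [hP, hR, hGdef, Matrix.mul_assoc]
        _ = P := by rw [hG1, Matrix.mul_one]
    rw [hN, Matrix.mul_sub, hPP, this, sub_self]
  have hNP : N * P = N := by rw [hN, Matrix.sub_mul, hPP, Matrix.mul_assoc, hRP]
  have hNN : N * N = 0 := by
    calc N * N = N * P * N := by rw [hNP]
      _ = 0 := by rw [Matrix.mul_assoc, hPN, Matrix.mul_zero]
  have hu : (1 + N) * (1 - N) = 1 := by simpa using one_add_smul_mul_one_sub_smul hNN 1
  have hu' : (1 - N) * (1 + N) = 1 := by
    simp [Matrix.sub_mul, Matrix.mul_add, hNN]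
  have hDP : (1 - N)ᵀ * Y * (1 - N) * P = R := by
    have e1 : (1 - N) * P = Y⁻¹ * R := by
      rw [Matrix.sub_mul, Matrix.one_mul, hNP, hN, sub_sub_cancel]
    have e2 : Nᵀ * R = 0 := by
      rw [← hPR, ← Matrix.mul_assoc, ← hPs, ← Matrix.transpose_mul, hPN, Matrix.transpose_zero,
        Matrix.zero_mul]
    rw [Matrix.mul_assoc, e1, Matrix.mul_assoc, ← Matrix.mul_assoc Y,
      mul_inv_cancel_of_posDef hY, Matrix.one_mul, Matrix.transpose_sub, Matrix.sub_mul, e2,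
      Matrix.transpose_one, Matrix.one_mul, sub_zero]
  have hD : ((1 - N)ᵀ * Y * (1 - N)).PosDef :=
    posDef_compress (Matrix.mulVec_injective_of_isUnit (IsUnit.of_mul_eq_one _ hu')) hY
  refine ⟨N, (1 - N)ᵀ * Y * (1 - N), hPN, hNP, hD, ?_, ?_, ?_⟩
  · rw [← hPκ, ← Matrix.mul_assoc, hDP, hR, Matrix.mul_assoc, hκ, Matrix.mul_one, hPκ]
  · rw [hDP]
    have := congrArg Matrix.transpose hDP
    rw [Matrix.transpose_mul, hPs, hRs, posDef_isSymm hD] at this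
    exact this.symm
  · calc Y = ((1 - N) * (1 + N))ᵀ * Y * ((1 - N) * (1 + N)) := by
          rw [hu', Matrix.transpose_one, Matrix.one_mul, Matrix.mul_one]
      _ = _ := by rw [Matrix.transpose_mul]; simp only [Matrix.mul_assoc]

/-- Complete the square and use √(s² + e) ≤ s + |e|/(2s) with s = t - β and e = γ - β². The error
tends to zero as t grows. -/
theorem sqrt_quadratic_le {t β γ : ℝ} (h : 0 < t - β) :
    Real.sqrt (t ^ 2 - 2 * t * β + γ) ≤ t - β + |γ - β ^ 2| / (2 * (t - β)) := by
  have h2 := abs_nonneg (γ - β ^ 2)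
  refine Real.sqrt_le_iff.2 ⟨by positivity, ?_⟩
  have h3 : (t - β + |γ - β ^ 2| / (2 * (t - β))) ^ 2
      = (t - β) ^ 2 + |γ - β ^ 2| + (|γ - β ^ 2| / (2 * (t - β))) ^ 2 := by
    field_simp
    ring
  rw [h3]
  nlinarith [le_abs_self (γ - β ^ 2), sq_nonneg (|γ - β ^ 2| / (2 * (t - β)))]

/-- The ray `r` has the matrix `c (P - (m / n) 1)` with `P` the projection onto the span of the
orthonormal system `κ`; here `c` is determined by `r` having unit speed. -/
structure GeodesicRay.IsVertexRay {n m : ℕ} (r : GeodesicRay n) (κ : Matrix (Fin n) (Fin m) ℝ)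
    (c : ℝ) : Prop where
  frame : κᵀ * κ = 1
  pos : 0 < c
  sq : c ^ 2 * (m * (n - m)) = n
  eq : r.A = c • (κ * κᵀ - ((m : ℝ) / n) • 1)

theorem isUnit_det_specialLinear {n : ℕ} (g : Matrix.SpecialLinearGroup (Fin n) ℝ) :
    IsUnit (g : Matrix (Fin n) (Fin n) ℝ).det := by
  rw [g.2]; exact isUnit_one

theorem compress_act_inv {n m : ℕ} (g : Matrix.SpecialLinearGroup (Fin n) ℝ)
    (κ : Matrix (Fin n) (Fin m) ℝ) (X : SymSpace n) :
    ((g : Matrix (Fin n) (Fin n) ℝ)ᵀ * κ)ᵀ * (X.act g).mat⁻¹ *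
      ((g : Matrix (Fin n) (Fin n) ℝ)ᵀ * κ) = κᵀ * X.mat⁻¹ * κ := by
  set G : Matrix (Fin n) (Fin n) ℝ := ↑g with hG
  have hu : IsUnit G.det := isUnit_det_specialLinear g
  have hu' : IsUnit Gᵀ.det := by rwa [Matrix.det_transpose]
  change (Gᵀ * κ)ᵀ * (Gᵀ * X.mat * G)⁻¹ * (Gᵀ * κ) = _
  rw [Matrix.mul_inv_rev, Matrix.mul_inv_rev, Matrix.transpose_mul, Matrix.transpose_transpose]
  calc κᵀ * G * (G⁻¹ * (X.mat⁻¹ * Gᵀ⁻¹)) * (Gᵀ * κ)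
      = κᵀ * (G * G⁻¹) * X.mat⁻¹ * (Gᵀ⁻¹ * Gᵀ) * κ := by simp only [Matrix.mul_assoc]
    _ = _ := by rw [Matrix.mul_nonsing_inv _ hu, Matrix.nonsing_inv_mul _ hu', Matrix.mul_one,
          Matrix.mul_one]

theorem logDetInv_act {n m : ℕ} (g : Matrix.SpecialLinearGroup (Fin n) ℝ)
    (κ : Matrix (Fin n) (Fin m) ℝ) (X : SymSpace n) :
    logDetInv ((g : Matrix (Fin n) (Fin n) ℝ)ᵀ * κ) (X.act g).mat = logDetInv κ X.mat := by
  rw [logDetInv, compress_act_inv, logDetInv]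

theorem SymSpace.act_act_inv {n : ℕ} (g : Matrix.SpecialLinearGroup (Fin n) ℝ)
    (X : SymSpace n) : (X.act g⁻¹).act g = X := by
  apply Subtype.ext
  change (g : Matrix (Fin n) (Fin n) ℝ)ᵀ *
    (((g⁻¹ : Matrix.SpecialLinearGroup (Fin n) ℝ) : Matrix (Fin n) (Fin n) ℝ)ᵀ * X.mat *
      ((g⁻¹ : Matrix.SpecialLinearGroup (Fin n) ℝ) : Matrix (Fin n) (Fin n) ℝ)) * g = X.mat
  have h : ((g⁻¹ : Matrix.SpecialLinearGroup (Fin n) ℝ) : Matrix (Fin n) (Fin n) ℝ) * g = 1 := by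
    rw [← Matrix.SpecialLinearGroup.coe_mul, inv_mul_cancel, Matrix.SpecialLinearGroup.coe_one]
  rw [Matrix.mul_assoc, Matrix.mul_assoc, Matrix.mul_assoc, h, Matrix.mul_one, ← Matrix.mul_assoc,
    ← Matrix.transpose_mul, h, Matrix.transpose_one, Matrix.one_mul]

theorem injective_transpose_mul {n m : ℕ} (g : Matrix.SpecialLinearGroup (Fin n) ℝ)
    {κ : Matrix (Fin n) (Fin m) ℝ} (hκ : Function.Injective κ.mulVec) :
    Function.Injective ((g : Matrix (Fin n) (Fin n) ℝ)ᵀ * κ).mulVec := by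
  intro x y hxy
  rw [← Matrix.mulVec_mulVec, ← Matrix.mulVec_mulVec] at hxy
  refine hκ (Matrix.mulVec_injective_of_isUnit ?_ hxy)
  rw [Matrix.isUnit_iff_isUnit_det, Matrix.det_transpose]
  exact isUnit_det_specialLinear g

theorem frame_card_le {n m : ℕ} {κ : Matrix (Fin n) (Fin m) ℝ}
    (hκ : Function.Injective κ.mulVec) : m ≤ n := by
  have h := LinearMap.finrank_le_finrank_of_injective (f := κ.mulVecLin) hκ
  simpa using h

namespace GeodesicRay.IsVertexRay

variable {n m : ℕ} {r : GeodesicRay n} {κ : Matrix (Fin n) (Fin m) ℝ} {c : ℝ}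

theorem smul_eq (h : r.IsVertexRay κ c) (t : ℝ) :
    t • r.A = (-(t * (c * m / n))) • 1 + (t * c) • (κ * κᵀ) := by
  rw [h.eq]
  module

theorem projection_sq (h : r.IsVertexRay κ c) : κ * κᵀ * (κ * κᵀ) = κ * κᵀ := by
  rw [Matrix.mul_assoc, ← Matrix.mul_assoc κᵀ, h.frame, Matrix.one_mul]

theorem exp_smul (h : r.IsVertexRay κ c) (t : ℝ) :
    NormedSpace.exp (t • r.A) = Real.exp (-(t * (c * m / n))) • (1 - κ * κᵀ)
      + Real.exp (-(t * (c * m / n)) + t * c) • (κ * κᵀ) := by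
  rw [h.smul_eq, exp_add_projection h.projection_sq]

theorem inv_eq_sqrt (h : r.IsVertexRay κ c) (hn : 0 < n) :
    Real.sqrt ((m : ℝ) * (n - m) / n) = c⁻¹ := by
  have hc := h.pos.ne'
  have hn' : (n : ℝ) ≠ 0 := by positivity
  have : (m : ℝ) * (n - m) / n = c⁻¹ ^ 2 := by
    rw [div_eq_iff hn', inv_pow, eq_inv_mul_iff_mul_eq₀ (pow_ne_zero 2 hc), h.sq]
  rw [this, Real.sqrt_sq (inv_pos.2 h.pos).le]

theorem point_eq_act (t : ℝ) : r.point t = (expPoint (t • r.A) (r.symm.smul t)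
    (by rw [Matrix.trace_smul, r.trace_zero, smul_zero])).act r.g := rfl

theorem compress_point_inv (h : r.IsVertexRay κ c) (t : ℝ) :
    ((r.g : Matrix (Fin n) (Fin n) ℝ)ᵀ * κ)ᵀ * (r.point t).mat⁻¹ *
      ((r.g : Matrix (Fin n) (Fin n) ℝ)ᵀ * κ) = Real.exp (-(t * (c * (1 - m / n)))) • 1 := by
  rw [point_eq_act, compress_act_inv]
  change κᵀ * (NormedSpace.exp (t • r.A))⁻¹ * κ = _
  -- The columns of κ are eigenvectors of the generator for its larger eigenvalue c(1 - m/n).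
  have h1 : (-(t • r.A)) * κ =
      κ * ((-(t * (c * (1 - m / n)))) • (1 : Matrix (Fin m) (Fin m) ℝ)) := by
    rw [h.eq, Matrix.neg_mul, Matrix.smul_mul, Matrix.smul_mul, Matrix.sub_mul, Matrix.mul_assoc,
      h.frame, Matrix.smul_mul, Matrix.mul_smul, Matrix.mul_one, Matrix.one_mul]
    module
  rw [← Matrix.exp_neg, Matrix.mul_assoc, exp_mul_of_mul_eq h1, exp_smul_one, Matrix.mul_smul,
    Matrix.mul_one, Matrix.mul_smul, h.frame]

/-- The determinant of the scalar matrix contributes m c(1 - m/n), which unit speed makes equal to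
1/c: along the ray the Lipschitz constant is attained. -/
theorem logDetInv_point (h : r.IsVertexRay κ c) (hn : 0 < n) (t : ℝ) :
    logDetInv ((r.g : Matrix (Fin n) (Fin n) ℝ)ᵀ * κ) (r.point t).mat = -(t / c) := by
  have hn' : (n : ℝ) ≠ 0 := by positivity
  have hc := h.pos.ne'
  rw [logDetInv, h.compress_point_inv, Matrix.det_smul, Matrix.det_one, mul_one, Fintype.card_fin,
    ← Real.exp_nat_mul, Real.log_exp]
  have := h.sq
  field_simp
  linear_combination (-t) * this

/-- The Lipschitz bound with constant 1/c, applied between Y and a point of the ray, where the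
function is -t/c. -/
theorem le_riemDist_point (h : r.IsVertexRay κ c) (hn : 0 < n) (Y : SymSpace n) (t : ℝ) :
    t + c * logDetInv ((r.g : Matrix (Fin n) (Fin n) ℝ)ᵀ * κ) Y.mat ≤ riemDist (r.point t) Y := by
  have hinj := injective_transpose_mul r.g (injective_of_frame h.frame)
  have h1 := logDetInv_sub_le hn (frame_card_le hinj) hinj (r.point t) Y
  rw [h.logDetInv_point hn, h.inv_eq_sqrt hn, ← div_eq_inv_mul, le_div_iff₀ h.pos] at h1
  have h2 : t / c * c = t := div_mul_cancel₀ _ h.pos.ne'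
  linarith

/-- The distance from the ray, up to an error that tends to zero. -/
theorem exists_riemDist_point_le (h : r.IsVertexRay κ c) (Y : SymSpace n) :
    ∃ γ ν : ℝ, ∀ t, riemDist (r.point t) Y ≤
      Real.sqrt (t ^ 2 - 2 * t *
        (-(c * logDetInv ((r.g : Matrix (Fin n) (Fin n) ℝ)ᵀ * κ) Y.mat)) + γ) +
      Real.sqrt (2 * Real.exp (-(t * c)) * ν) := by
  -- Moving back by the isometry g turns the ray into exp(tA).
  set Y₀ := Y.act r.g⁻¹ with hY₀
  have hYY : Y₀.act r.g = Y := Y.act_act_inv r.g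
  obtain ⟨N, D, hPN, hNP, hD, hDκ, hDP, hY⟩ := exists_block_decomposition h.frame Y₀.2.1
  obtain ⟨B, hB, hBD, hBt, hBc⟩ := exists_log_of_posDef hD
  have hdet : ∀ t : ℝ, (1 + t • N).det = 1 := by
    intro t
    rw [← hNP, ← Matrix.smul_mul, Matrix.det_one_add_mul_comm, Matrix.mul_smul, hPN, smul_zero,
      add_zero, Matrix.det_one]
  have hNN : N * N = 0 := by
    rw [← hNP, Matrix.mul_assoc, ← Matrix.mul_assoc (κ * κᵀ), hPN, Matrix.zero_mul,
      Matrix.mul_zero]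
  have hd1 : (1 + N).det = 1 := by simpa using hdet 1
  have hB0 : B.trace = 0 := by
    have h1 : Y₀.1.det = 1 := Y₀.2.2
    rw [hY, Matrix.det_mul, Matrix.det_mul, Matrix.det_transpose, hd1, one_mul, mul_one] at h1
    rw [hBt, h1, Real.log_one]
  let u : Matrix.SpecialLinearGroup (Fin n) ℝ := ⟨1 + N, hd1⟩
  have hBY : Y₀ = (expPoint B hB hB0).act u := by
    apply Subtype.ext
    change Y₀.1 = (1 + N)ᵀ * NormedSpace.exp B * (1 + N)
    rw [hBD]
    exact hY
  have hBP := hBc _ hDP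
  have hAt : ∀ t : ℝ, (t • r.A).trace = 0 := fun t => by
    rw [Matrix.trace_smul, r.trace_zero, smul_zero]
  -- the value of `log det` at `Y`
  have hF : logDetInv ((r.g : Matrix (Fin n) (Fin n) ℝ)ᵀ * κ) Y.mat = -(B * (κ * κᵀ)).trace := by
    have h1 : B * κ = κ * (κᵀ * B * κ) := by
      calc B * κ = B * (κ * κᵀ) * κ := by
            rw [Matrix.mul_assoc, Matrix.mul_assoc κ, h.frame, Matrix.mul_one]
        _ = _ := by rw [hBP]; simp only [Matrix.mul_assoc]
    have h2 := exp_mul_of_mul_eq h1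
    have h3 : (κᵀ * Y₀.1⁻¹ * κ)⁻¹ = NormedSpace.exp (κᵀ * B * κ) := by
      have := congrArg (fun M => κᵀ * M) (hDκ.symm.trans ((congrArg (· * κ) hBD.symm).trans h2))
      simpa [← Matrix.mul_assoc, h.frame] using this
    have hs : (κᵀ * B * κ).IsSymm := by
      simp [Matrix.IsSymm, Matrix.transpose_mul, hB.eq, Matrix.mul_assoc]
    have h4 := det_exp_of_isSymm hs
    rw [← h3, Matrix.det_nonsing_inv, Ring.inverse_eq_inv'] at h4
    rw [← hYY, logDetInv_act, logDetInv]
    change Real.log (κᵀ * Y₀.1⁻¹ * κ).det = _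
    rw [← neg_inj, ← Real.log_inv, h4, Real.log_exp, neg_neg, Matrix.mul_assoc,
      Matrix.trace_mul_comm, Matrix.mul_assoc]
  -- The cross term of the squared norm of tA - B. The scalar part of A does not contribute since B
  -- is traceless.
  have hAB : (r.A * B).trace = -(c * -(B * (κ * κᵀ)).trace) := by
    rw [h.eq, Matrix.smul_mul, Matrix.sub_mul, Matrix.smul_mul, Matrix.one_mul, Matrix.trace_smul,
      Matrix.trace_sub, Matrix.trace_smul, hB0, Matrix.trace_mul_comm]
    simp
  refine ⟨(B * B).trace, (N * Nᵀ).trace, fun t => ?_⟩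
  rw [hF]
  have hcomm : Commute B (t • r.A) := by
    rw [h.smul_eq]
    refine Commute.add_right ?_ ?_
    · exact (Commute.one_right B).smul_right _
    · exact Commute.smul_right hBP _
  -- The segment from exp B to exp(tA) inside the flat, translated by u = 1 + N: it runs from Y₀ to
  -- u.exp(tA).
  have j1 := (joinedBy_exp hB hB0 (r.symm.smul t) (hAt t) hcomm).act u
  rw [← hBY] at j1
  have hE := h.exp_smul t
  have hNTP : Nᵀ * (κ * κᵀ) = 0 := by
    have := congrArg Matrix.transpose hPN
    simpa [Matrix.transpose_mul, Matrix.mul_assoc] using this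
  have hPNT : κ * κᵀ * Nᵀ = Nᵀ := by
    have := congrArg Matrix.transpose hNP
    simpa [Matrix.transpose_mul, Matrix.mul_assoc] using this
  -- Nᵀ maps the range of 1 - P to that of P and kills the latter; on these ranges exp(tA) acts by
  -- scalars with ratio exp(-tc).
  have hδ : Nᵀ * NormedSpace.exp (t • r.A)
      = Real.exp (-(t * c)) • (NormedSpace.exp (t • r.A) * Nᵀ) := by
    rw [hE, Matrix.mul_add, Matrix.add_mul, Matrix.mul_smul, Matrix.mul_smul, Matrix.smul_mul,
      Matrix.smul_mul, Matrix.mul_sub, Matrix.sub_mul, hNTP, hPNT, Matrix.mul_one, Matrix.one_mul,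
      sub_self, smul_zero, smul_zero, zero_add, add_zero, sub_zero, smul_smul, ← Real.exp_add]
    congr 2
    ring
  -- The remaining piece joins exp(tA) to u.exp(tA); its length decays like exp(-tc/2).
  have j2 := joinedBy_shear (X := expPoint (t • r.A) (r.symm.smul t) (hAt t))
    (Y := (expPoint (t • r.A) (r.symm.smul t) (hAt t)).act u) hNN hdet hδ rfl
  have j3 := ((JoinedBy.concat j1 (joinedBy_symm j2)).act r.g).riemDist_le
  rw [hYY, ← point_eq_act, riemDist_comm] at j3
  refine j3.trans (le_of_eq ?_)
  congr 2
  rw [← hAB]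
  have hu := r.unit_speed
  simp only [Matrix.sub_mul, Matrix.mul_sub, Matrix.smul_mul, Matrix.mul_smul, Matrix.trace_sub,
    Matrix.trace_smul, hu, smul_eq_mul, Matrix.trace_mul_comm B r.A]
  ring

/-- Squeezed between the Lipschitz lower bound and the length of the explicit path, whose shear part
disappears in the limit. -/
theorem tendsto_riemDist_point_sub (h : r.IsVertexRay κ c) (hn : 0 < n) (Y : SymSpace n) :
    Tendsto (fun t => riemDist (r.point t) Y - t) atTop
      (𝓝 (c * logDetInv ((r.g : Matrix (Fin n) (Fin n) ℝ)ᵀ * κ) Y.mat)) := by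
  obtain ⟨γ, ν, hb⟩ := h.exists_riemDist_point_le Y
  set F := c * logDetInv ((r.g : Matrix (Fin n) (Fin n) ℝ)ᵀ * κ) Y.mat with hF
  have h1 : Tendsto (fun t : ℝ => F + |γ - (-F) ^ 2| / (2 * (t - -F)) +
      Real.sqrt (2 * Real.exp (-(t * c)) * ν)) atTop (𝓝 (F + 0 + Real.sqrt (2 * 0 * ν))) := by
    refine Tendsto.add (tendsto_const_nhds.add ?_) ?_
    · refine tendsto_const_nhds.div_atTop ?_
      exact (tendsto_atTop_add_const_right _ _ tendsto_id).const_mul_atTop two_pos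
    · refine (Real.continuous_sqrt.tendsto _).comp ?_
      refine Tendsto.mul_const _ (Tendsto.const_mul _ ?_)
      exact Real.tendsto_exp_neg_atTop_nhds_zero.comp (tendsto_id.atTop_mul_const h.pos)
  rw [mul_zero, zero_mul, Real.sqrt_zero, add_zero, add_zero] at h1
  refine tendsto_of_tendsto_of_tendsto_of_le_of_le' tendsto_const_nhds h1 ?_ ?_
  · exact Eventually.of_forall fun t => by linarith [h.le_riemDist_point hn Y t]
  · filter_upwards [eventually_gt_atTop (-F)] with t ht
    have h2 := sqrt_quadratic_le (t := t) (β := -F) (γ := γ) (by linarith)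
    linarith [hb t]

theorem tendsto_busemannDiff (h : r.IsVertexRay κ c) (hn : 0 < n) (X Y : SymSpace n) :
    Tendsto (busemannDiff r X Y) atTop
      (𝓝 (c * (logDetInv ((r.g : Matrix (Fin n) (Fin n) ℝ)ᵀ * κ) Y.mat -
        logDetInv ((r.g : Matrix (Fin n) (Fin n) ℝ)ᵀ * κ) X.mat))) := by
  have h1 := (h.tendsto_riemDist_point_sub hn Y).sub (h.tendsto_riemDist_point_sub hn X)
  rw [← mul_sub] at h1
  refine h1.congr fun t => ?_
  rw [busemannDiff]
  ring

end GeodesicRay.IsVertexRay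

/-! ### Rays in the class of a vertex -/

theorem trace_combination_sq {n m : ℕ} {P : Matrix (Fin n) (Fin n) ℝ} (hPP : P * P = P)
    (hPt : P.trace = m) (a c : ℝ) :
    ((a • 1 + c • P) * (a • 1 + c • P)).trace = a ^ 2 * n + 2 * a * c * m + c ^ 2 * m := by
  simp only [Matrix.add_mul, Matrix.mul_add, Matrix.smul_mul, Matrix.mul_smul, Matrix.one_mul,
    Matrix.mul_one, hPP, Matrix.trace_add, Matrix.trace_smul, Matrix.trace_one, hPt,
    Fintype.card_fin, smul_eq_mul]
  ring

theorem trace_frame {n m : ℕ} {κ : Matrix (Fin n) (Fin m) ℝ} (hκ : κᵀ * κ = 1) :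
    (κ * κᵀ).trace = m := by
  rw [Matrix.trace_mul_comm, hκ, Matrix.trace_one, Fintype.card_fin]

theorem frame_projection_sq {n m : ℕ} {κ : Matrix (Fin n) (Fin m) ℝ} (hκ : κᵀ * κ = 1) :
    κ * κᵀ * (κ * κᵀ) = κ * κᵀ := by
  rw [Matrix.mul_assoc, ← Matrix.mul_assoc κᵀ, hκ, Matrix.one_mul]

namespace GeodesicRay

variable {n m : ℕ}

/-- A ray with two eigenvalues `a < a + c` is a vertex ray. -/
theorem isVertexRay_of_eq {r : GeodesicRay n} {κ : Matrix (Fin n) (Fin m) ℝ} (hn : 0 < n)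
    (hκ : κᵀ * κ = 1) {a c : ℝ} (hc : 0 < c) (hA : r.A = a • 1 + c • (κ * κᵀ)) :
    r.IsVertexRay κ c := by
  have hn' : (n : ℝ) ≠ 0 := by positivity
  have h1 := r.trace_zero
  have h2 := r.unit_speed
  rw [hA, trace_combination_sq (frame_projection_sq hκ) (trace_frame hκ)] at h2
  rw [hA, Matrix.trace_add, Matrix.trace_smul, Matrix.trace_smul, trace_frame hκ,
    Matrix.trace_one, Fintype.card_fin, smul_eq_mul, smul_eq_mul] at h1
  have ha : a = -(c * m / n) := by
    field_simp
    linarith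
  refine ⟨hκ, hc, ?_, ?_⟩
  · rw [ha] at h2
    field_simp at h2
    linarith
  · rw [hA, ha]
    module

/-- The sum of the eigenspaces for eigenvalues `≥ c`, in an orthonormal eigenbasis. -/
theorem mem_iSup_eigenspace_iff {A U : Matrix (Fin n) (Fin n) ℝ} {d : Fin n → ℝ}
    (h1 : Uᵀ * U = 1) (h2 : U * Uᵀ = 1) (hA : A = U * Matrix.diagonal d * Uᵀ) (c : ℝ)
    (x : Fin n → ℝ) :
    x ∈ (⨆ (μ : ℝ) (_ : c ≤ μ), Module.End.eigenspace (Matrix.toLin' A) μ) ↔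
      ∀ j, d j < c → (Uᵀ *ᵥ x) j = 0 := by
  constructor
  · intro hx
    let S : Submodule ℝ (Fin n → ℝ) :=
      { carrier := {y | ∀ j, d j < c → (Uᵀ *ᵥ y) j = 0}
        add_mem' := fun ha hb j hj => by
          rw [Matrix.mulVec_add, Pi.add_apply, ha j hj, hb j hj, add_zero]
        zero_mem' := fun j _ => by simp
        smul_mem' := fun a y hy j hj => by
          rw [Matrix.mulVec_smul, Pi.smul_apply, hy j hj, smul_zero] }
    have hS : (⨆ (μ : ℝ) (_ : c ≤ μ), Module.End.eigenspace (Matrix.toLin' A) μ) ≤ S := by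
      refine iSup₂_le fun μ hμ y hy j hj => ?_
      rw [Module.End.mem_eigenspace_iff, Matrix.toLin'_apply] at hy
      have h3 : Uᵀ *ᵥ (A *ᵥ y) = Matrix.diagonal d *ᵥ (Uᵀ *ᵥ y) := by
        rw [hA, Matrix.mulVec_mulVec, Matrix.mulVec_mulVec, ← Matrix.mul_assoc,
          ← Matrix.mul_assoc, h1, Matrix.one_mul]
      have h4 := congrFun h3 j
      rw [hy, Matrix.mulVec_diagonal, Matrix.mulVec_smul, Pi.smul_apply, smul_eq_mul] at h4
      have h5 : (μ - d j) * (Uᵀ *ᵥ y) j = 0 := by linarith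
      exact (mul_eq_zero.1 h5).resolve_left (by linarith)
    exact hS hx
  · intro hx
    have h3 : x = ∑ j, (Uᵀ *ᵥ x) j • (U *ᵥ Pi.single j 1) := by
      conv_lhs => rw [← Matrix.one_mulVec x, ← h2, ← Matrix.mulVec_mulVec,
        ← Finset.univ_sum_single (Uᵀ *ᵥ x), Matrix.mulVec_sum]
      refine Finset.sum_congr rfl fun j _ => ?_
      rw [← Matrix.mulVec_smul, ← Pi.single_smul', smul_eq_mul, mul_one]
    rw [h3]
    refine Submodule.sum_mem _ fun j _ => ?_
    rcases lt_or_ge (d j) c with hj | hj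
    · rw [hx j hj, zero_smul]
      exact Submodule.zero_mem _
    · refine Submodule.smul_mem _ _ (le_iSup₂ (f := fun (μ : ℝ) (_ : c ≤ μ) =>
        Module.End.eigenspace (Matrix.toLin' A) μ) (d j) hj ?_)
      rw [Module.End.mem_eigenspace_iff, Matrix.toLin'_apply, hA, Matrix.mulVec_mulVec,
        Matrix.mul_assoc, h1, Matrix.mul_one, ← Matrix.mulVec_mulVec, Matrix.diagonal_mulVec_single,
        ← Matrix.mulVec_smul, ← Pi.single_smul', smul_eq_mul]

theorem toLin_transpose_injective (r : GeodesicRay n) :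
    Function.Injective (Matrix.toLin' (r.g : Matrix (Fin n) (Fin n) ℝ)ᵀ) := by
  refine Matrix.mulVec_injective_of_isUnit ?_
  rw [Matrix.isUnit_iff_isUnit_det, Matrix.det_transpose]
  exact isUnit_det_specialLinear r.g

theorem range_transpose_mul (r : GeodesicRay n) {κ : Matrix (Fin n) (Fin m) ℝ}
    {W : Submodule ℝ (Fin n → ℝ)} (hκ : LinearMap.range κ.mulVecLin = W) :
    LinearMap.range ((r.g : Matrix (Fin n) (Fin n) ℝ)ᵀ * κ).mulVecLin
      = W.map (Matrix.toLin' (r.g : Matrix (Fin n) (Fin n) ℝ)ᵀ) := by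
  rw [Matrix.mulVecLin_mul, LinearMap.range_comp, hκ]
  rfl

/-- A ray whose flag is a single subspace is a vertex ray. -/
theorem exists_isVertexRay_of_flag {r : GeodesicRay n} {V : Submodule ℝ (Fin n → ℝ)}
    (hV : Module.finrank ℝ V = m) (hr : r.flag = {V}) :
    ∃ (κ : Matrix (Fin n) (Fin m) ℝ) (c : ℝ), r.IsVertexRay κ c ∧
      LinearMap.range ((r.g : Matrix (Fin n) (Fin n) ℝ)ᵀ * κ).mulVecLin = V := by
  obtain ⟨U, d, h1, h2, hA⟩ := exists_orthogonal_diagonalization r.symm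
  have hinj := r.toLin_transpose_injective
  set S : ℝ → Submodule ℝ (Fin n → ℝ) := fun c =>
    ⨆ (μ : ℝ) (_ : c ≤ μ), Module.End.eigenspace (Matrix.toLin' r.A) μ with hS
  have hmem : ∀ c x, x ∈ S c ↔ ∀ j, d j < c → (Uᵀ *ᵥ x) j = 0 := fun c x =>
    mem_iSup_eigenspace_iff h1 h2 hA c x
  have hbasis : ∀ i j, (Uᵀ *ᵥ (U *ᵥ Pi.single i 1)) j = if j = i then 1 else 0 := fun i j => by
    rw [Matrix.mulVec_mulVec, h1, Matrix.one_mulVec, Pi.single_apply]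
  have hemem : ∀ i c, U *ᵥ Pi.single i 1 ∈ S c ↔ c ≤ d i := fun i c => by
    rw [hmem]
    constructor
    · intro h
      by_contra! hc
      have := h i hc
      rw [hbasis] at this
      simp at this
    · intro h j hj
      rw [hbasis, if_neg]
      rintro rfl
      linarith
  have hup : ∀ c, r.upperSpace c = (S c).map (Matrix.toLin' (r.g : Matrix (Fin n) (Fin n) ℝ)ᵀ) :=
    fun c => rfl
  have hmapinj := Submodule.map_injective_of_injective hinj
  obtain ⟨⟨c₀, hc₀⟩, hbot, htop⟩ : V ∈ r.flag := by rw [hr]; rfl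
  have hSbot : S c₀ ≠ ⊥ := fun h => hbot (by rw [hc₀, hup, h, Submodule.map_bot])
  have hStop : S c₀ ≠ ⊤ := fun h => htop (by
    rw [hc₀, hup, h, Submodule.map_top, LinearMap.range_eq_top]
    exact LinearMap.surjective_of_injective hinj)
  obtain ⟨i₁, hi₁⟩ : ∃ i, c₀ ≤ d i := by
    by_contra! h
    apply hSbot
    rw [eq_bot_iff]
    intro x hx
    have h3 : Uᵀ *ᵥ x = 0 := funext fun j => (hmem c₀ x).1 hx j (h j)
    rw [Submodule.mem_bot, ← Matrix.one_mulVec x, ← h2, ← Matrix.mulVec_mulVec, h3,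
      Matrix.mulVec_zero]
  obtain ⟨i₀, hi₀⟩ : ∃ i, d i < c₀ := by
    by_contra! h
    exact hStop (eq_top_iff.2 fun x _ => (hmem c₀ x).2 fun j hj => absurd (h j) (not_le.2 hj))
  have : Nonempty (Fin n) := ⟨i₀⟩
  -- Eigenvalues above the minimum d k all give proper nonzero members of the flag: the eigenvector
  -- of index k is missing from them. The flag has one member, so these eigenvalues coincide and A
  -- has exactly two eigenvalues.
  obtain ⟨k, hk⟩ := Finite.exists_min d
  have hk0 : d k < c₀ := (hk i₀).trans_lt hi₀
  have hW : ∀ j, d k < d j → S (d j) = S c₀ := by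
    intro j hj
    have : r.upperSpace (d j) ∈ r.flag := by
      refine ⟨⟨_, rfl⟩, fun h => ?_, fun h => ?_⟩
      · have h3 : S (d j) = ⊥ := hmapinj (by rw [← hup, h, Submodule.map_bot])
        have h4 := (hemem j (d j)).2 le_rfl
        rw [h3, Submodule.mem_bot] at h4
        have h5 := hbasis j j
        rw [h4] at h5
        simp at h5
      · have h4 : Matrix.toLin' (r.g : Matrix (Fin n) (Fin n) ℝ)ᵀ (U *ᵥ Pi.single k 1) ∈
            r.upperSpace (d j) := by rw [h]; exact Submodule.mem_top
        rw [hup] at h4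
        obtain ⟨y, hy, hyk⟩ := h4
        rw [hinj hyk] at hy
        exact absurd ((hemem k (d j)).1 hy) (not_le.2 hj)
    rw [hr, Set.mem_singleton_iff, hc₀, hup, hup] at this
    exact hmapinj this
  have hval : ∀ j, d k < d j → d j = d i₁ := by
    intro j hj
    have hi : d k < d i₁ := hk0.trans_le hi₁
    have h3 := (hW j hj).trans (hW i₁ hi).symm
    apply le_antisymm
    · exact (hemem i₁ (d j)).1 (h3 ▸ (hemem i₁ (d i₁)).2 le_rfl)
    · exact (hemem j (d i₁)).1 (h3 ▸ (hemem j (d j)).2 le_rfl)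
  have hfin : Module.finrank ℝ (S c₀) = m := by
    rw [← hV, hc₀, hup]
    exact (LinearEquiv.finrank_eq (Submodule.equivMapOfInjective _ hinj _))
  obtain ⟨κ, hκ, hκr⟩ := exists_isOrthonormalFrame (S c₀) hfin
  refine ⟨κ, d i₁ - d k, isVertexRay_of_eq i₀.pos hκ (a := d k) ?_ ?_, ?_⟩
  · linarith
  · have hAe : ∀ j, r.A *ᵥ (U *ᵥ Pi.single j 1) = d j • (U *ᵥ Pi.single j 1) := by
      intro j
      rw [hA, Matrix.mulVec_mulVec,
        Matrix.mul_assoc, h1, Matrix.mul_one, ← Matrix.mulVec_mulVec,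
        Matrix.diagonal_mulVec_single, ← Matrix.mulVec_smul, ← Pi.single_smul', smul_eq_mul]
    have hPe : ∀ j, (d k • (1 : Matrix (Fin n) (Fin n) ℝ) + (d i₁ - d k) • (κ * κᵀ)) *ᵥ
        (U *ᵥ Pi.single j 1) = d j • (U *ᵥ Pi.single j 1) := by
      intro j
      rw [Matrix.add_mulVec, Matrix.smul_mulVec, Matrix.smul_mulVec, Matrix.one_mulVec]
      rcases (hk j).eq_or_lt with hj | hj
      -- An eigenvector for the smallest eigenvalue is orthogonal to the upper space, which the
      -- columns of κ span.
      · have h3 : κᵀ *ᵥ (U *ᵥ Pi.single j 1) = 0 := by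
          ext i
          have h4 : κ *ᵥ Pi.single i 1 ∈ S c₀ := by rw [← hκr]; exact ⟨_, rfl⟩
          have h5 := (hmem _ _).1 h4 j (hj ▸ hk0)
          rw [Matrix.mulVec_mulVec, Matrix.mulVec_single_one] at h5 ⊢
          rw [← Matrix.transpose_transpose (κᵀ * U), Matrix.transpose_mul,
            Matrix.transpose_transpose]
          exact h5
        rw [← Matrix.mulVec_mulVec, h3, Matrix.mulVec_zero, smul_zero, add_zero, hj]
      · have h3 : U *ᵥ Pi.single j 1 ∈ S c₀ := by rw [← hW j hj, hemem]
        rw [← hκr] at h3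
        obtain ⟨z, hz⟩ := h3
        rw [Matrix.mulVecLin_apply] at hz
        rw [← hz, Matrix.mulVec_mulVec, Matrix.mul_assoc, hκ, Matrix.mul_one, hval j hj]
        module
    have h6 : r.A * U = (d k • (1 : Matrix (Fin n) (Fin n) ℝ) + (d i₁ - d k) • (κ * κᵀ)) * U := by
      refine Matrix.ext_of_mulVec_single fun j => ?_
      rw [← Matrix.mulVec_mulVec, ← Matrix.mulVec_mulVec, hAe, hPe]
    have h7 := congrArg (· * Uᵀ) h6
    simpa only [Matrix.mul_assoc, h2, Matrix.mul_one] using h7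
  · rw [r.range_transpose_mul hκr, ← hup, hc₀]

end GeodesicRay

/-! ### Rays asymptotic to a vertex ray -/

theorem det_compress_replicateCol {n : ℕ} (M : Matrix (Fin n) (Fin n) ℝ) (x : Fin n → ℝ) :
    ((Matrix.replicateCol (Fin 1) x)ᵀ * M * Matrix.replicateCol (Fin 1) x).det
      = x ⬝ᵥ M *ᵥ x := by
  rw [Matrix.det_fin_one, Matrix.mul_assoc, ← Matrix.replicateCol_mulVec]
  simp [Matrix.mul_apply, dotProduct]

theorem dotProduct_transpose_mul_mul_mulVec {n m : ℕ} (M : Matrix (Fin n) (Fin n) ℝ)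
    (K : Matrix (Fin n) (Fin m) ℝ) (z : Fin m → ℝ) :
    z ⬝ᵥ (Kᵀ * M * K) *ᵥ z = (K *ᵥ z) ⬝ᵥ M *ᵥ (K *ᵥ z) := by
  rw [← Matrix.mulVec_mulVec, ← Matrix.mulVec_mulVec, Matrix.dotProduct_mulVec z Kᵀ,
    Matrix.vecMul_transpose]

theorem replicateCol_mulVec_injective {n : ℕ} {x : Fin n → ℝ} (hx : x ≠ 0) :
    Function.Injective (Matrix.replicateCol (Fin 1) x).mulVec := by
  intro a b hab
  obtain ⟨i, hi⟩ := Function.ne_iff.1 hx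
  have h := congrFun hab i
  simp only [Matrix.mulVec, dotProduct, Matrix.replicateCol_apply, Finset.univ_unique,
    Finset.sum_singleton] at h
  ext j
  rw [Subsingleton.elim j default]
  exact mul_left_cancel₀ hi h

/-- Jensen's inequality for the exponential of a symmetric matrix. -/
theorem exp_dotProduct_le {n : ℕ} {M : Matrix (Fin n) (Fin n) ℝ} (hM : M.IsSymm)
    {y : Fin n → ℝ} (hy : y ⬝ᵥ y = 1) :
    Real.exp (y ⬝ᵥ M *ᵥ y) ≤ y ⬝ᵥ NormedSpace.exp M *ᵥ y := by
  obtain ⟨U, d, h1, h2, rfl⟩ := exists_orthogonal_diagonalization hM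
  have key : ∀ e : Fin n → ℝ, y ⬝ᵥ (U * Matrix.diagonal e * Uᵀ) *ᵥ y
      = ∑ i, (Uᵀ *ᵥ y) i ^ 2 * e i := by
    intro e
    rw [← Matrix.mulVec_mulVec, ← Matrix.mulVec_mulVec, Matrix.dotProduct_mulVec,
      ← Matrix.mulVec_transpose]
    refine Finset.sum_congr rfl fun i _ => ?_
    rw [Matrix.mulVec_diagonal]
    ring
  have hs : ∑ i, (Uᵀ *ᵥ y) i ^ 2 = 1 := by
    have h := key fun _ => 1
    rw [Matrix.diagonal_one, Matrix.mul_one, h2, Matrix.one_mulVec, hy] at h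
    simpa using h.symm
  rw [exp_orthogonal_conj d h1 h2, key, key]
  simpa using convexOn_exp.map_sum_le (t := Finset.univ) (w := fun i => (Uᵀ *ᵥ y) i ^ 2) (p := d)
    (fun i _ => sq_nonneg _) hs (fun i _ => Set.mem_univ _)

namespace GeodesicRay

variable {n m : ℕ}

theorem exists_riemDist_le_of_endpoint_eq {r s : GeodesicRay n} (h : r.endpoint = s.endpoint) :
    ∃ K : ℝ, ∀ᶠ t in atTop, riemDist (r.point t) (s.point t) ≤ K := by
  have h1 : r.Asymptotic s := Quotient.exact h
  obtain ⟨C, hC, h2⟩ := (r.asymptotic_iff s).1 h1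
  exact ⟨C.toReal, h2.mono fun t ht => ENNReal.toReal_mono hC.ne ht⟩

/-- The one-column case of `compress_act_inv`: for a vector moved by g, the quadratic form of the
inverse point reduces to that of exp(-tA). -/
theorem point_inv_compress {s : GeodesicRay n} (y : Fin n → ℝ) (t : ℝ) :
    ((s.g : Matrix (Fin n) (Fin n) ℝ)ᵀ *ᵥ y) ⬝ᵥ
      (s.point t).mat⁻¹ *ᵥ ((s.g : Matrix (Fin n) (Fin n) ℝ)ᵀ *ᵥ y)
      = y ⬝ᵥ NormedSpace.exp (-(t • s.A)) *ᵥ y := by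
  have h := congrArg Matrix.det (compress_act_inv s.g (Matrix.replicateCol (Fin 1) y)
    (expPoint (t • s.A) (s.symm.smul t) (by rw [Matrix.trace_smul, s.trace_zero, smul_zero])))
  rw [← Matrix.replicateCol_mulVec, det_compress_replicateCol, det_compress_replicateCol] at h
  rw [IsVertexRay.point_eq_act, h, Matrix.exp_neg]
  rfl

/-- Along a ray asymptotic to a vertex ray, vectors in the vertex subspace have at least the
growth rate of the vertex ray. -/
theorem IsVertexRay.le_dotProduct {r s : GeodesicRay n} {κ : Matrix (Fin n) (Fin m) ℝ} {c : ℝ}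
    (h : r.IsVertexRay κ c) (hrs : r.endpoint = s.endpoint) {y : Fin n → ℝ} (hy : y ⬝ᵥ y = 1)
    (hyV : (s.g : Matrix (Fin n) (Fin n) ℝ)ᵀ *ᵥ y ∈
      LinearMap.range ((r.g : Matrix (Fin n) (Fin n) ℝ)ᵀ * κ).mulVecLin) :
    c * (1 - m / n) ≤ y ⬝ᵥ s.A *ᵥ y := by
  obtain ⟨K, hK⟩ := exists_riemDist_le_of_endpoint_eq hrs
  obtain ⟨z, hz⟩ := hyV
  rw [Matrix.mulVecLin_apply] at hz
  set x := (s.g : Matrix (Fin n) (Fin n) ℝ)ᵀ *ᵥ y with hx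
  have hy0 : y ≠ 0 := by rintro rfl; simp at hy
  have hn : 0 < n := by
    rcases Nat.eq_zero_or_pos n with h0 | h0
    · subst h0; exact absurd (Subsingleton.elim _ _) hy0
    · exact h0
  have hx0 : x ≠ 0 := by
    intro h0
    apply hy0
    apply s.toLin_transpose_injective
    rw [Matrix.toLin'_apply, ← hx, h0, map_zero]
  have hz0 : z ≠ 0 := by
    rintro rfl
    rw [Matrix.mulVec_zero] at hz
    exact hx0 hz.symm
  have hzz : 0 < z ⬝ᵥ z := by
    have := Matrix.dotProduct_star_self_pos_iff.2 hz0
    simpa using this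
  have hr : ∀ t, x ⬝ᵥ (r.point t).mat⁻¹ *ᵥ x = Real.exp (-(t * (c * (1 - m / n)))) * (z ⬝ᵥ z) := by
    intro t
    have h1 := h.compress_point_inv t
    rw [← hz, ← dotProduct_transpose_mul_mul_mulVec, h1, Matrix.smul_mulVec, Matrix.one_mulVec,
      dotProduct_smul, smul_eq_mul]
  -- The Lipschitz constant for the line spanned by x, that is, for m = 1.
  set C := Real.sqrt (((1 : ℕ) : ℝ) * (n - (1 : ℕ)) / n) with hC
  have key : ∀ᶠ t : ℝ in atTop,
      t * (c * (1 - m / n) - y ⬝ᵥ s.A *ᵥ y) ≤ Real.log (z ⬝ᵥ z) + C * K := by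
    filter_upwards [hK] with t ht
    have h1 := logDetInv_sub_le (m := 1) hn hn (replicateCol_mulVec_injective hx0) (r.point t) (s.point t)
    rw [logDetInv, logDetInv, det_compress_replicateCol, det_compress_replicateCol, hr t,
      point_inv_compress, Real.log_mul (Real.exp_pos _).ne' hzz.ne', Real.log_exp] at h1
    have h2 := exp_dotProduct_le (s.symm.smul t).neg hy
    have h3 := Real.log_le_log (Real.exp_pos _) h2
    rw [Real.log_exp, Matrix.neg_mulVec, Matrix.smul_mulVec, dotProduct_neg, dotProduct_smul,
      smul_eq_mul] at h3
    have h4 : C * riemDist (r.point t) (s.point t) ≤ C * K :=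
      mul_le_mul_of_nonneg_left ht (Real.sqrt_nonneg _)
    rw [← hC] at h1
    linarith
  by_contra! hlt
  -- If the rate of s were smaller, the left side of `key` would grow linearly, although it is
  -- bounded.
  have h5 : Tendsto (fun t : ℝ => t * (c * (1 - m / n) - y ⬝ᵥ s.A *ᵥ y)) atTop atTop :=
    tendsto_id.atTop_mul_const (by linarith)
  obtain ⟨t, ht1, ht2⟩ := (key.and (h5.eventually_gt_atTop (Real.log (z ⬝ᵥ z) + C * K))).exists
  linarith

/-- Every ray asymptotic to a vertex ray is a vertex ray, with the same subspace. -/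
theorem IsVertexRay.exists_of_endpoint_eq {r s : GeodesicRay n} {κ : Matrix (Fin n) (Fin m) ℝ}
    {c : ℝ} (h : r.IsVertexRay κ c) (hn : 0 < n) (hrs : r.endpoint = s.endpoint) :
    ∃ κ' : Matrix (Fin n) (Fin m) ℝ, s.IsVertexRay κ' c ∧
      LinearMap.range ((s.g : Matrix (Fin n) (Fin n) ℝ)ᵀ * κ').mulVecLin =
        LinearMap.range ((r.g : Matrix (Fin n) (Fin n) ℝ)ᵀ * κ).mulVecLin := by
  set V := LinearMap.range ((r.g : Matrix (Fin n) (Fin n) ℝ)ᵀ * κ).mulVecLin with hV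
  have hinj := s.toLin_transpose_injective
  set f := Matrix.toLin' (s.g : Matrix (Fin n) (Fin n) ℝ)ᵀ with hf
  have hWV : (V.comap f).map f = V :=
    Submodule.map_comap_eq_of_surjective (LinearMap.surjective_of_injective hinj) V
  have hfin : Module.finrank ℝ (V.comap f) = m := by
    rw [LinearEquiv.finrank_eq (Submodule.equivMapOfInjective f hinj (V.comap f)), hWV, hV,
      LinearMap.finrank_range_of_inj (injective_transpose_mul r.g (injective_of_frame h.frame))]
    simp
  obtain ⟨κ', hκ, hκr⟩ := exists_isOrthonormalFrame (V.comap f) hfin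
  refine ⟨κ', ⟨hκ, h.pos, h.sq, ?_⟩, by rw [s.range_transpose_mul hκr, ← hf, hWV]⟩
  have hn' : (n : ℝ) ≠ 0 := by positivity
  -- The growth estimate summed over the orthonormal columns of κ', which span the pullback of V
  -- under the action of s.g.
  have htr : m * (c * (1 - m / n)) ≤ (κ' * κ'ᵀ * s.A).trace := by
    rw [Matrix.mul_assoc, Matrix.trace_mul_comm, Matrix.trace]
    have h1 : ∀ j ∈ Finset.univ, c * (1 - (m : ℝ) / n) ≤ (κ'ᵀ * s.A * κ').diag j := by
      intro j _
      have hj : (κ'ᵀ * κ') j j = 1 := by rw [hκ, Matrix.one_apply_eq]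
      have hmem : (s.g : Matrix (Fin n) (Fin n) ℝ)ᵀ *ᵥ (κ'.col j) ∈ V := by
        have : κ'.col j ∈ V.comap f := by
          rw [← hκr]
          exact ⟨Pi.single j 1, by rw [Matrix.mulVecLin_apply, Matrix.mulVec_single_one]⟩
        exact this
      have h2 := h.le_dotProduct hrs (y := κ'.col j) hj hmem
      refine h2.trans (le_of_eq ?_)
      rw [Matrix.diag_apply, Matrix.mul_assoc]
      rfl
    have h2 := Finset.card_nsmul_le_sum _ _ _ h1
    rw [Finset.card_univ, Fintype.card_fin, nsmul_eq_mul] at h2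
    exact h2
  set P := κ' * κ'ᵀ with hP
  have hPP : P * P = P := frame_projection_sq hκ
  have hPt : P.trace = m := trace_frame hκ
  have hPs : P.IsSymm := by simp [Matrix.IsSymm, hP, Matrix.transpose_mul]
  -- The generator that s ought to have. It has norm 1 like s.A, and the trace estimate shows that
  -- their pairing is at least 1, so the squared norm of s.A - R is at most 2 - 2 = 0.
  set R := (-(c * (m / n))) • (1 : Matrix (Fin n) (Fin n) ℝ) + c • P with hR
  have hRs : R.IsSymm := (Matrix.isSymm_one.smul _).add (hPs.smul _)
  have hRR : (R * R).trace = 1 := by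
    rw [hR, trace_combination_sq hPP hPt]
    have := h.sq
    field_simp
    linear_combination this
  have hRA : (R * s.A).trace = c * (P * s.A).trace := by
    rw [hR, Matrix.add_mul, Matrix.smul_mul, Matrix.smul_mul, Matrix.one_mul, Matrix.trace_add,
      Matrix.trace_smul, Matrix.trace_smul, s.trace_zero, smul_zero, zero_add, smul_eq_mul]
  have hge : 1 ≤ (R * s.A).trace := by
    rw [hRA]
    have h1 := mul_le_mul_of_nonneg_left htr h.pos.le
    have h2 : c * (m * (c * (1 - m / n))) = 1 := by
      have := h.sq
      field_simp
      linear_combination this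
    linarith
  have hz : s.A - R = 0 := by
    refine eq_zero_of_trace_mul_self_le (s.symm.sub hRs) ?_
    rw [Matrix.sub_mul, Matrix.mul_sub, Matrix.mul_sub, Matrix.trace_sub, Matrix.trace_sub,
      Matrix.trace_sub, s.unit_speed, hRR, Matrix.trace_mul_comm s.A R]
    linarith
  rw [sub_eq_zero.1 hz, hR]
  module

end GeodesicRay

/-- The constant of a vertex ray is determined by the dimensions. -/
theorem GeodesicRay.IsVertexRay.const_eq {n m : ℕ} {r : GeodesicRay n}
    {κ : Matrix (Fin n) (Fin m) ℝ} {c : ℝ} (h : r.IsVertexRay κ c) (hn : 0 < n) :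
    c = (Real.sqrt ((m : ℝ) * (n - m) / n))⁻¹ := by
  rw [h.inv_eq_sqrt hn, inv_inv]

/-- Two matrices with the same column space give the same differences of `logDetInv`. -/
theorem logDetInv_sub_eq_of_range_eq {n m : ℕ} {ι κ : Matrix (Fin n) (Fin m) ℝ}
    (hι : Function.Injective ι.mulVec) (hκ : Function.Injective κ.mulVec)
    (h : LinearMap.range ι.mulVecLin = LinearMap.range κ.mulVecLin) (X Y : SymSpace n) :
    logDetInv ι Y.mat - logDetInv ι X.mat = logDetInv κ Y.mat - logDetInv κ X.mat := by
  have h1 : ∀ j, ∃ z, κ *ᵥ z = ι.col j := by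
    intro j
    have : ι.col j ∈ LinearMap.range κ.mulVecLin := by
      rw [← h]
      exact ⟨Pi.single j 1, by rw [Matrix.mulVecLin_apply, Matrix.mulVec_single_one]⟩
    exact this
  choose z hz using h1
  have hR : ι = κ * Matrix.of fun i j => z j i := by
    ext i j
    exact (congrFun (hz j) i).symm
  set R : Matrix (Fin m) (Fin m) ℝ := Matrix.of fun i j => z j i with hRdef
  have hdet : R.det ≠ 0 := by
    have hRi : Function.Injective R.mulVec := by
      intro a b hab
      apply hι
      rw [hR, ← Matrix.mulVec_mulVec, ← Matrix.mulVec_mulVec, hab]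
    exact ((Matrix.isUnit_iff_isUnit_det _).1 (Matrix.mulVec_injective_iff_isUnit.1 hRi)).ne_zero
  -- The change of basis R multiplies the determinant by (det R)², independently of Z.
  have key : ∀ Z : SymSpace n, logDetInv ι Z.mat = Real.log (R.det * R.det) + logDetInv κ Z.mat := by
    intro Z
    have h2 : ιᵀ * Z.mat⁻¹ * ι = Rᵀ * (κᵀ * Z.mat⁻¹ * κ) * R := by
      rw [hR, Matrix.transpose_mul]
      simp only [Matrix.mul_assoc]
    have h3 : (κᵀ * Z.mat⁻¹ * κ).det ≠ 0 := (posDef_compress hκ Z.2.1.inv).det_pos.ne'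
    rw [logDetInv, h2, Matrix.det_mul, Matrix.det_mul, Matrix.det_transpose, logDetInv,
      ← Real.log_mul (mul_ne_zero hdet hdet) h3]
    congr 1
    ring
  rw [key, key]
  ring

/-- The classical Busemann function of a vertex. -/
theorem tendsto_busemannDiff_of_isIdealVertex {n m : ℕ} (hn : 0 < n)
    {ξ : VisualBoundary n} {V : Submodule ℝ (Fin n → ℝ)} (hξ : IsIdealVertex ξ V)
    (hV : Module.finrank ℝ V = m) {ι : Matrix (Fin n) (Fin m) ℝ}
    (hι : Function.Injective ι.mulVec) (hιV : LinearMap.range ι.mulVecLin = V)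
    {r : GeodesicRay n} (hr : r.endpoint = ξ) (X Y : SymSpace n) :
    Tendsto (busemannDiff r X Y) atTop
      (𝓝 ((Real.sqrt ((m : ℝ) * (n - m) / n))⁻¹ *
        (logDetInv ι Y.mat - logDetInv ι X.mat))) := by
  obtain ⟨s, hs, hflag⟩ := hξ
  obtain ⟨κ, c, hκ, hκV⟩ := GeodesicRay.exists_isVertexRay_of_flag hV hflag
  obtain ⟨κ', hκ', hκV'⟩ := hκ.exists_of_endpoint_eq hn (hs.trans hr.symm)
  rw [← hκ'.const_eq hn, logDetInv_sub_eq_of_range_eq hι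
    (injective_transpose_mul r.g (injective_of_frame hκ'.frame))
    (hιV.trans (hκV'.trans hκV).symm)]
  exact hκ'.tendsto_busemannDiff hn X Y

theorem busemann_eq_of_isIdealVertex {n m : ℕ} (hn : 0 < n)
    {ξ : VisualBoundary n} {V : Submodule ℝ (Fin n → ℝ)} (hξ : IsIdealVertex ξ V)
    (hV : Module.finrank ℝ V = m) {ι : Matrix (Fin n) (Fin m) ℝ}
    (hι : Function.Injective ι.mulVec) (hιV : LinearMap.range ι.mulVecLin = V)
    (X Y : SymSpace n) :
    busemann ξ X Y = (Real.sqrt ((m : ℝ) * (n - m) / n))⁻¹ *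
        (logDetInv ι Y.mat - logDetInv ι X.mat) :=
  (tendsto_busemannDiff_of_isIdealVertex hn hξ hV hι hιV (Quotient.out_eq ξ) X Y).limUnder_eq

/-! ### Limits in the Satake compactification -/

/-- The function `[S] ↦ tr (M S) tr (N S) / tr (S S)` on the projective space. -/
def projQuotient {n : ℕ} (M N : Matrix (Fin n) (Fin n) ℝ) : ℙ ℝ (symMatrices n) → ℝ :=
  Projectivization.lift (fun S : {S : symMatrices n // S ≠ 0} =>
    (M * (S.1 : Matrix (Fin n) (Fin n) ℝ)).trace * (N * (S.1 : Matrix (Fin n) (Fin n) ℝ)).trace /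
      ((S.1 : Matrix (Fin n) (Fin n) ℝ) * S.1).trace) (by
    rintro ⟨a, ha⟩ ⟨b, hb⟩ t (rfl : a = t • b)
    have ht : t ≠ 0 := by
      rintro rfl
      exact ha (zero_smul _ _)
    simp only [Submodule.coe_smul, Matrix.mul_smul, Matrix.smul_mul, Matrix.trace_smul, smul_eq_mul]
    field_simp)

theorem trace_mul_self_ne_zero {n : ℕ} {S : Matrix (Fin n) (Fin n) ℝ} (hS : S.IsSymm)
    (h0 : S ≠ 0) : (S * S).trace ≠ 0 := fun h => h0 (eq_zero_of_trace_mul_self_le hS h.le)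

/-- On nonzero symmetric matrices the denominator is a nonzero squared norm, so this function of
degree zero has no poles on the projective space. -/
theorem continuous_projQuotient {n : ℕ} (M N : Matrix (Fin n) (Fin n) ℝ) :
    Continuous (projQuotient M N) := by
  refine Continuous.quotient_lift (s := projectivizationSetoid ℝ (symMatrices n)) ?_ _
  have h : Continuous fun S : {S : symMatrices n // S ≠ 0} => (S.1 : Matrix (Fin n) (Fin n) ℝ) :=
    continuous_subtype_val.comp continuous_subtype_val
  refine Continuous.div ?_ ?_ ?_
  · fun_prop
  · fun_prop
  · exact fun S => trace_mul_self_ne_zero S.1.2 fun h0 => S.2 (Subtype.ext h0)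

theorem continuous_projectivization_mk {n : ℕ} :
    Continuous fun S : {S : symMatrices n // S ≠ 0} => Projectivization.mk ℝ S.1 S.2 :=
  continuous_quotient_mk' (s := projectivizationSetoid ℝ (symMatrices n))

/-- With X⁻¹ = k kᵀ the trace is that of the positive semidefinite matrix kᵀSk, which vanishes only
if S does, k being invertible. -/
theorem trace_inv_mul_pos {n : ℕ} {X S : Matrix (Fin n) (Fin n) ℝ} (hX : X.PosDef)
    (hS : S.PosSemidef) (h0 : S ≠ 0) : 0 < (X⁻¹ * S).trace := by
  obtain ⟨k, hk⟩ := exists_eq_mul_transpose hX.inv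
  have h1 : (X⁻¹ * S).trace = (kᵀ * S * k).trace := by
    rw [hk, Matrix.mul_assoc, Matrix.trace_mul_comm]
  have h2 : (kᵀ * S * k).PosSemidef := by
    rw [← Matrix.conjTranspose_eq_transpose_of_trivial]
    exact hS.conjTranspose_mul_mul_same k
  rw [h1]
  refine lt_of_le_of_ne h2.trace_nonneg fun h3 => h0 ?_
  have h4 := h2.trace_eq_zero_iff.1 h3.symm
  have h5 : X * k * kᵀ = 1 := by rw [Matrix.mul_assoc, ← hk, mul_inv_cancel_of_posDef hX]
  have h6 : k * kᵀ * X = 1 := by rw [← hk, inv_mul_cancel_of_posDef hX]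
  calc S = (X * k * kᵀ) * S * (k * kᵀ * X) := by rw [h5, h6, Matrix.one_mul, Matrix.mul_one]
    _ = X * k * (kᵀ * S * k) * (kᵀ * X) := by simp only [Matrix.mul_assoc]
    _ = 0 := by rw [h4, Matrix.mul_zero, Matrix.zero_mul]

/-- Single traces are not functions on the projective space. Both numerator and denominator are
therefore multiplied by tr(X⁻¹A)/tr(A²), which makes each continuous there and leaves the ratio
unchanged; positivity of tr(X⁻¹S) permits division in the limit. -/
theorem tendsto_selbergRatio {n : ℕ} {S : Matrix (Fin n) (Fin n) ℝ} (hS : S.PosSemidef)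
    (h0 : S ≠ 0) (X Y : SymSpace n) :
    Tendsto (selbergRatio X Y) (satakeApproach (satakePoint S hS h0))
      (𝓝 ((Y.mat⁻¹ * S).trace / (X.mat⁻¹ * S).trace)) := by
  set α := satakePoint S hS h0 with hα
  have hSs : S.IsSymm := by
    have h := hS.1
    rwa [Matrix.IsHermitian, Matrix.conjTranspose_eq_transpose_of_trivial] at h
  have hq := trace_mul_self_ne_zero hSs h0
  have hx : (X.mat⁻¹ * S).trace ≠ 0 := (trace_inv_mul_pos X.2.1 hS h0).ne'
  have h1 : ∀ M N : Matrix (Fin n) (Fin n) ℝ, Tendsto (fun A : SymSpace n =>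
      (M * A.mat).trace * (N * A.mat).trace / (A.mat * A.mat).trace) (satakeApproach α)
      (𝓝 ((M * S).trace * (N * S).trace / (S * S).trace)) := by
    intro M N
    have h2 : Continuous fun p : SatakeCompactification n => projQuotient M N p.1 :=
      (continuous_projQuotient M N).comp continuous_subtype_val
    exact (h2.tendsto α).comp tendsto_comap
  have h2 := (h1 Y.mat⁻¹ X.mat⁻¹).div (h1 X.mat⁻¹ X.mat⁻¹)
    (div_ne_zero (mul_ne_zero hx hx) hq)
  -- For b = 0 both sides are 0 by the convention for division by zero.
  have e : ∀ {a b q : ℝ}, q ≠ 0 → a * b / q / (b * b / q) = a / b := by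
    intro a b q hq'
    rcases eq_or_ne b 0 with rfl | hb
    · simp
    · field_simp
  rw [e hq] at h2
  refine h2.congr fun A => ?_
  rw [Pi.div_apply, selbergRatio, selbergInvariant, selbergInvariant]
  refine e (trace_mul_self_ne_zero (posDef_isSymm A.2.1) fun hA => ?_)
  have hd : A.mat.det = 1 := A.2.2
  have : Nonempty (Fin n) := ⟨⟨0, α.pos⟩⟩
  rw [hA, Matrix.det_zero] at hd
  exact zero_ne_one hd

theorem exists_toSatake_eq {n : ℕ} (hn : 0 < n) {M : Matrix (Fin n) (Fin n) ℝ} (hM : M.PosDef)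
    (h0 : M ≠ 0) : ∃ Z : SymSpace n, Z.toSatake hn = satakePoint M hM.posSemidef h0 := by
  have hd := hM.det_pos
  have hc := Real.rpow_pos_of_pos hd (1 / (n : ℝ))
  refine ⟨⟨(M.det ^ (1 / (n : ℝ)))⁻¹ • M, hM.smul (inv_pos.2 hc), ?_⟩, ?_⟩
  · rw [Matrix.det_smul, Fintype.card_fin, inv_pow, ← Real.rpow_natCast, ← Real.rpow_mul hd.le,
      one_div, inv_mul_cancel₀ (by positivity), Real.rpow_one, inv_mul_cancel₀ hd.ne']
  · apply Subtype.ext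
    refine (Projectivization.mk_eq_mk_iff' ℝ _ _ _ _).2 ⟨(M.det ^ (1 / (n : ℝ)))⁻¹, ?_⟩
    exact Subtype.ext rfl

/-- The boundary point is a limit of points of the symmetric space, namely of the classes of S +
|ε|1; without this the limit along the filter would not be unique. The absolute value keeps the path
semidefinite for every real ε. -/
theorem satakeApproach_neBot {n : ℕ} {S : Matrix (Fin n) (Fin n) ℝ} (hS : S.PosSemidef)
    (h0 : S ≠ 0) : (satakeApproach (satakePoint S hS h0)).NeBot := by
  set α := satakePoint S hS h0 with hα
  have hpsd : ∀ ε : ℝ, (S + |ε| • (1 : Matrix (Fin n) (Fin n) ℝ)).PosSemidef := fun ε =>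
    hS.add (Matrix.PosSemidef.one.smul (abs_nonneg ε))
  have hne : ∀ ε : ℝ, S + |ε| • (1 : Matrix (Fin n) (Fin n) ℝ) ≠ 0 := by
    intro ε h
    have h1 := congrArg Matrix.trace h
    rw [Matrix.trace_add, Matrix.trace_smul, Matrix.trace_one, Matrix.trace_zero, smul_eq_mul] at h1
    have h2 : 0 ≤ |ε| * (Fintype.card (Fin n) : ℝ) := by positivity
    have h3 := hS.trace_nonneg
    exact h0 (hS.trace_eq_zero_iff.1 (by linarith))
  set q : ℝ → SatakeCompactification n := fun ε => satakePoint _ (hpsd ε) (hne ε) with hq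
  have hqc : Continuous q := by
    let f : ℝ → {S : symMatrices n // S ≠ 0} := fun ε =>
      ⟨⟨S + |ε| • 1, by
        have h := (hpsd ε).1
        rwa [Matrix.IsHermitian, Matrix.conjTranspose_eq_transpose_of_trivial] at h⟩,
        fun h => hne ε (congrArg Subtype.val h)⟩
    have hf : Continuous f := by
      have hc : Continuous fun ε : ℝ => S + |ε| • (1 : Matrix (Fin n) (Fin n) ℝ) := by fun_prop
      exact (hc.subtype_mk _).subtype_mk _
    exact (continuous_projectivization_mk.comp hf).subtype_mk _
  have hq0 : q 0 = α := by
    apply Subtype.ext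
    simp [hq, hα, satakePoint]
  have hlim : Tendsto q (𝓝[≠] 0) (𝓝 α) := by
    rw [← hq0]
    exact (hqc.tendsto 0).mono_left nhdsWithin_le_nhds
  rw [satakeApproach, comap_neBot_iff]
  intro t ht
  obtain ⟨ε, hε, hε0⟩ := ((hlim.eventually ht).and self_mem_nhdsWithin).exists
  have hpd : (S + |ε| • (1 : Matrix (Fin n) (Fin n) ℝ)).PosDef :=
    Matrix.PosDef.posSemidef_add hS (Matrix.PosDef.one.smul (abs_pos.2 hε0))
  obtain ⟨Z, hZ⟩ := exists_toSatake_eq α.pos hpd (hne ε)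
  exact ⟨Z, by rw [hZ]; exact hε⟩

theorem busemannSelberg_satakePoint {n : ℕ} {S : Matrix (Fin n) (Fin n) ℝ} (hS : S.PosSemidef)
    (h0 : S ≠ 0) (X Y : SymSpace n) :
    busemannSelberg (satakePoint S hS h0) X Y
      = (Y.mat⁻¹ * S).trace / (X.mat⁻¹ * S).trace :=
  have := satakeApproach_neBot hS h0
  (tendsto_selbergRatio hS h0 X Y).limUnder_eq

theorem trace_mul_vecMulVec_self {n : ℕ} (M : Matrix (Fin n) (Fin n) ℝ) (v : Fin n → ℝ) :
    (M * Matrix.vecMulVec v v).trace = v ⬝ᵥ M *ᵥ v := by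
  rw [Matrix.mul_vecMulVec, Matrix.trace_vecMulVec, dotProduct_comm]

theorem tendsto_busemannSelberg_rankOnePoint {n : ℕ} {v : Fin n → ℝ} (hv : v ≠ 0)
    (X Y : SymSpace n) : Tendsto (selbergRatio X Y) (satakeApproach (rankOnePoint v hv))
      (𝓝 (busemannSelberg (rankOnePoint v hv) X Y)) := by
  rw [rankOnePoint, busemannSelberg_satakePoint]
  exact tendsto_selbergRatio _ _ X Y

theorem busemannSelberg_rankOnePoint {n : ℕ} {v : Fin n → ℝ} (hv : v ≠ 0) (X Y : SymSpace n) :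
    busemannSelberg (rankOnePoint v hv) X Y = (v ⬝ᵥ Y.mat⁻¹ *ᵥ v) / (v ⬝ᵥ X.mat⁻¹ *ᵥ v) := by
  rw [rankOnePoint, busemannSelberg_satakePoint, trace_mul_vecMulVec_self,
    trace_mul_vecMulVec_self]

theorem dotProduct_inv_mulVec_pos {n : ℕ} {v : Fin n → ℝ} (hv : v ≠ 0) (X : SymSpace n) :
    0 < v ⬝ᵥ X.mat⁻¹ *ᵥ v := by
  have h := (posDef_compress (replicateCol_mulVec_injective hv) X.2.1.inv).det_pos
  rwa [det_compress_replicateCol] at h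

/-- A representative of a rank one point. -/
theorem exists_rep_rankOnePoint {n : ℕ} {v : Fin n → ℝ} (hv : v ≠ 0) :
    ∃ a : ℝ, a ≠ 0 ∧ (rankOnePoint v hv).rep = a • Matrix.vecMulVec v v := by
  have h : (rankOnePoint v hv).1 = Projectivization.mk ℝ (rankOnePoint v hv).1.rep
    (rankOnePoint v hv).1.rep_nonzero := (Projectivization.mk_rep _).symm
  obtain ⟨a, ha⟩ := (Projectivization.mk_eq_mk_iff' ℝ _ _ _ _).1 h.symm
  have ha' : (rankOnePoint v hv).rep = a • Matrix.vecMulVec v v := (congrArg Subtype.val ha).symm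
  refine ⟨a, ?_, ha'⟩
  rintro rfl
  exact (rankOnePoint v hv).rep_ne_zero (by rw [ha', zero_smul])

/-- The chosen representative is a multiple a vvᵀ with a ≠ 0, so its value at v is a nonzero
multiple of v lying in the column space. -/
theorem mem_of_rankOnePoint_mem {n : ℕ} {V : Submodule ℝ (Fin n → ℝ)} {v : Fin n → ℝ}
    (hv : v ≠ 0) (h : rankOnePoint v hv ∈ satakeComponentBoundary V) : v ∈ V := by
  obtain ⟨a, ha, hrep⟩ := exists_rep_rankOnePoint hv
  have h1 : (rankOnePoint v hv).rep *ᵥ v ∈ V := colSpace_le_of_mem_boundary h ⟨v, rfl⟩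
  have hvv : v ⬝ᵥ v ≠ 0 := by simpa using hv
  rw [hrep, Matrix.smul_mulVec, Matrix.vecMulVec_mulVec, op_smul_eq_smul, smul_smul] at h1
  exact (V.smul_mem_iff (mul_ne_zero ha hvv)).1 h1

/-- Since ιᵀι = 1, compression takes v = ιw back to w; the scalar in the chosen representative is
absorbed by the projective class. -/
theorem rankOnePoint_proj {n m : ℕ} {V : Submodule ℝ (Fin n → ℝ)}
    {ι : Matrix (Fin n) (Fin m) ℝ} (hι : IsOrthonormalFrame ι V) {v : Fin n → ℝ} (hv : v ≠ 0)
    (hα : rankOnePoint v hv ∈ satakeComponentBoundary V) {w : Fin m → ℝ} (hw : w ≠ 0)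
    (hvw : ι *ᵥ w = v) : (rankOnePoint v hv).proj hι hα = rankOnePoint w hw := by
  obtain ⟨a, ha, hrep⟩ := exists_rep_rankOnePoint hv
  apply Subtype.ext
  refine (Projectivization.mk_eq_mk_iff' ℝ _ _ _ _).2 ⟨a, Subtype.ext ?_⟩
  change a • Matrix.vecMulVec w w = ιᵀ * (rankOnePoint v hv).rep * ι
  rw [hrep, Matrix.mul_smul, Matrix.smul_mul, Matrix.mul_vecMulVec, Matrix.vecMulVec_mul, ← hvw,
    Matrix.mulVec_mulVec, hι.1, Matrix.one_mulVec, ← Matrix.vecMul_transpose, Matrix.vecMul_vecMul,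
    hι.1, Matrix.vecMul_one]

theorem dualProj_inv {n m : ℕ} {V : Submodule ℝ (Fin n → ℝ)}
    {ι : Matrix (Fin n) (Fin m) ℝ} (hι : IsOrthonormalFrame ι V) (X : SymSpace n) :
    (X.dualProj hι).mat⁻¹
      = ((ιᵀ * X.mat⁻¹ * ι).det ^ (1 / (m : ℝ)))⁻¹ • (ιᵀ * X.mat⁻¹ * ι) := by
  change ((X.inv.proj hι).1⁻¹)⁻¹ = _
  rw [Matrix.nonsing_inv_nonsing_inv _ (by rw [(X.inv.proj hι).2.2]; exact isUnit_one)]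
  rfl

/-! ### Comparison of the two kinds of Busemann functions -/

theorem range_replicateCol {n : ℕ} (v : Fin n → ℝ) :
    LinearMap.range (Matrix.replicateCol (Fin 1) v).mulVecLin = Submodule.span ℝ {v} := by
  rw [Matrix.range_mulVecLin]
  congr 1
  ext x
  simp [Set.mem_range, eq_comm, funext_iff]

theorem log_busemannSelberg_rankOnePoint {n : ℕ} {v : Fin n → ℝ} (hv : v ≠ 0) (X Y : SymSpace n) :
    Real.log (busemannSelberg (rankOnePoint v hv) X Y)
      = logDetInv (Matrix.replicateCol (Fin 1) v) Y.mat
        - logDetInv (Matrix.replicateCol (Fin 1) v) X.mat := by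
  rw [busemannSelberg_rankOnePoint, Real.log_div (dotProduct_inv_mulVec_pos hv Y).ne'
    (dotProduct_inv_mulVec_pos hv X).ne', logDetInv, logDetInv, det_compress_replicateCol,
    det_compress_replicateCol]

theorem busemannSelberg_rankOnePoint_pos {n : ℕ} {v : Fin n → ℝ} (hv : v ≠ 0) (X Y : SymSpace n) :
    0 < busemannSelberg (rankOnePoint v hv) X Y := by
  rw [busemannSelberg_rankOnePoint]
  exact div_pos (dotProduct_inv_mulVec_pos hv Y) (dotProduct_inv_mulVec_pos hv X)

/-- The two inversions in the dual projection cancel, so the quadratic form at w is that of X⁻¹ at v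
= ιw divided by the normalizing m-th root of a determinant. The logarithm of this root is the
correction term that produces the Busemann function of V. -/
theorem logDetInv_replicateCol_dualProj {n m : ℕ} {V : Submodule ℝ (Fin n → ℝ)}
    {ι : Matrix (Fin n) (Fin m) ℝ} (hι : IsOrthonormalFrame ι V) {v : Fin n → ℝ} (hv : v ≠ 0)
    {w : Fin m → ℝ} (hvw : ι *ᵥ w = v) (X : SymSpace n) :
    logDetInv (Matrix.replicateCol (Fin 1) w) (X.dualProj hι).mat
      = logDetInv (Matrix.replicateCol (Fin 1) v) X.mat - (1 / (m : ℝ)) * logDetInv ι X.mat := by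
  have hd : 0 < (ιᵀ * X.mat⁻¹ * ι).det :=
    (posDef_compress hι.mulVec_injective X.2.1.inv).det_pos
  have hp := Real.rpow_pos_of_pos hd (1 / (m : ℝ))
  rw [logDetInv, logDetInv, logDetInv, det_compress_replicateCol, det_compress_replicateCol,
    dualProj_inv, Matrix.smul_mulVec, dotProduct_smul, dotProduct_transpose_mul_mul_mulVec, hvw,
    smul_eq_mul, Real.log_mul (inv_pos.2 hp).ne' (dotProduct_inv_mulVec_pos hv X).ne',
    Real.log_inv, Real.log_rpow hd]
  ring

end

/-! ### The comparison formulas -/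

theorem proposition3p2 {n k : ℕ} (hk : 0 < k) (hnk : k + 2 ≤ n)
    (V : Submodule ℝ (Fin n → ℝ)) (hV : Module.finrank ℝ V = n - k)
    (ι : Matrix (Fin n) (Fin (n - k)) ℝ) (hι : IsOrthonormalFrame ι V)
    (v : Fin n → ℝ) (hv : v ≠ 0) (hα : rankOnePoint v hv ∈ satakeComponentBoundary V)
    (ξv ξV : VisualBoundary n)
    (hξv : IsIdealVertex ξv (Submodule.span ℝ {v})) (hξV : IsIdealVertex ξV V)
    (X Y : SymSpace n) :
    -- all the limits defining the four functions exist, and do not depend on choices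
    Filter.Tendsto (selbergRatio X Y) (satakeApproach (rankOnePoint v hv))
      (nhds (busemannSelberg (rankOnePoint v hv) X Y)) ∧
    Filter.Tendsto (selbergRatio (X.dualProj hι) (Y.dualProj hι))
      (satakeApproach ((rankOnePoint v hv).proj hι hα))
      (nhds (busemannSelbergHigher hι (rankOnePoint v hv) hα X Y)) ∧
    (∀ r : GeodesicRay n, r.endpoint = ξv →
      Filter.Tendsto (busemannDiff r X Y) Filter.atTop (nhds (busemann ξv X Y))) ∧
    (∀ r : GeodesicRay n, r.endpoint = ξV →
      Filter.Tendsto (busemannDiff r X Y) Filter.atTop (nhds (busemann ξV X Y))) ∧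
    -- the logarithms are taken of positive numbers
    0 < busemannSelberg (rankOnePoint v hv) X Y ∧
    0 < busemannSelbergHigher hι (rankOnePoint v hv) hα X Y ∧
    -- the two formulas
    Real.log (busemannSelberg (rankOnePoint v hv) X Y) =
      Real.sqrt (((n : ℝ) - 1) / n) * busemann ξv X Y ∧
    Real.log (busemannSelbergHigher hι (rankOnePoint v hv) hα X Y) =
      Real.sqrt (((n : ℝ) - 1) / n) * busemann ξv X Y -
        Real.sqrt ((k : ℝ) / (n * ((n : ℝ) - k))) * busemann ξV X Y := by
  have hn : 0 < n := by omega
  have hvi := replicateCol_mulVec_injective hv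
  have hvr := range_replicateCol v
  have hv1 : Module.finrank ℝ (Submodule.span ℝ {v}) = 1 := finrank_span_singleton hv
  have hιi := hι.mulVec_injective
  -- The coordinates w of v in the frame ι: the projected boundary point is again of rank one, given
  -- by w.
  obtain ⟨w, hw⟩ : v ∈ LinearMap.range ι.mulVecLin := by
    rw [hι.2]; exact mem_of_rankOnePoint_mem hv hα
  rw [Matrix.mulVecLin_apply] at hw
  have hw0 : w ≠ 0 := by
    rintro rfl
    rw [Matrix.mulVec_zero] at hw
    exact hv hw.symm
  have hproj := rankOnePoint_proj hι hv hα hw0 hw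
  have hbv := busemann_eq_of_isIdealVertex hn hξv hv1 hvi hvr X Y
  have hbV := busemann_eq_of_isIdealVertex hn hξV hV hιi hι.2 X Y
  have hkR : (0 : ℝ) < k := by exact_mod_cast hk
  have hnR : (k : ℝ) + 2 ≤ n := by exact_mod_cast hnk
  have hn0 : (0 : ℝ) < n := by linarith
  have hmR : (0 : ℝ) < n - k := by linarith
  have hmc : ((n - k : ℕ) : ℝ) = n - k := Nat.cast_sub (by omega)
  have hs1 : 0 < Real.sqrt (((n : ℝ) - 1) / n) :=
    Real.sqrt_pos.2 (div_pos (by linarith) hn0)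
  have hfv : Real.sqrt (((n : ℝ) - 1) / n) * busemann ξv X Y
      = logDetInv (Matrix.replicateCol (Fin 1) v) Y.mat
        - logDetInv (Matrix.replicateCol (Fin 1) v) X.mat := by
    rw [hbv, Nat.cast_one, one_mul, mul_inv_cancel_left₀ hs1.ne']
  have hfV : Real.sqrt ((k : ℝ) / (n * ((n : ℝ) - k))) * busemann ξV X Y
      = (1 / ((n - k : ℕ) : ℝ)) * (logDetInv ι Y.mat - logDetInv ι X.mat) := by
    -- With m = n - k the Lipschitz constant √(m(n - m)/n) is m times the coefficient √(k/(n(n -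
    -- k))); the quotient of the two is the 1/m from normalizing the determinant.
    have h1 : ((n : ℝ) - k) * (n - (n - k)) / n = (n - k) ^ 2 * (k / (n * (n - k))) := by
      field_simp
      ring
    have h2 : Real.sqrt ((k : ℝ) / (n * ((n : ℝ) - k))) ≠ 0 :=
      (Real.sqrt_pos.2 (by positivity)).ne'
    rw [hbV, hmc, h1, Real.sqrt_mul (sq_nonneg _), Real.sqrt_sq hmR.le]
    field_simp
  refine ⟨tendsto_busemannSelberg_rankOnePoint hv X Y, ?_, ?_, ?_,
    busemannSelberg_rankOnePoint_pos hv X Y, ?_, ?_, ?_⟩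
  · rw [busemannSelbergHigher, hproj]
    exact tendsto_busemannSelberg_rankOnePoint hw0 _ _
  · intro r hr
    rw [hbv]
    exact tendsto_busemannDiff_of_isIdealVertex hn hξv hv1 hvi hvr hr X Y
  · intro r hr
    rw [hbV]
    exact tendsto_busemannDiff_of_isIdealVertex hn hξV hV hιi hι.2 hr X Y
  · rw [busemannSelbergHigher, hproj]
    exact busemannSelberg_rankOnePoint_pos hw0 _ _
  · rw [hfv, log_busemannSelberg_rankOnePoint]
  · rw [hfv, hfV, busemannSelbergHigher, hproj, log_busemannSelberg_rankOnePoint,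
      logDetInv_replicateCol_dualProj hι hv hw, logDetInv_replicateCol_dualProj hι hv hw]
    ring
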